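/- **Setting.** Let $v_1,v_2\in\mathbb R^d$ and $\Gamma_i,W_i\in\mathbb R^{d\times d}$ $(i=1,2)$, and put $h_i(\theta,w)=v_i-\Gamma_i\theta-W_iw$. Norms are Euclidean and induced operator norms. Assume: (A1) $W_2$ and $X_1:=\Gamma_1-W_1W_2^{-1}\Gamma_2$ are positive definite (not necessarily symmetric). Put $b_1:=v_1-W_1W_2^{-1}v_2$, $\lambda(\theta):=W_2^{-1}(v_2-\Gamma_2\theta)$, $\theta^*:=X_1^{-1}b_1$. (A2) The stepsizes $\alpha_n,\beta_n>0$ and $\eta_n:=\alpha_n/\beta_n$ satisfy $\sum_n\alpha_n=\sum_n\beta_n=\infty$, $\alpha_n,\beta_n,\eta_n\le 1$, and $\alpha_n,\beta_n,\eta_n\to0$. Put $t_n:=\sum_{k<n}\alpha_k$, $s_n:=\sum_{k<n}\beta_k$. The process, for $n\ge n_0$, is $$\theta_{n+1}=\theta_n+\alpha_n[h_1(\theta_n,w_n)+M^{(1)}_{n+1}],\qquad w_{n+1}=w_n+\beta_n[h_2(\theta_n,w_n)+M^{(2)}_{n+1}],\qquad z_n:=w_n-\lambda(\theta_n).$$ (A3)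 $(M^{(1)}_{n})$, $(M^{(2)}_{n})$, $n>n_0$, are martingale difference sequences with respect to $\mathcal F_n=\sigma(\theta_{n_0},w_{n_0},M^{(1)}_{n_0+1},M^{(2)}_{n_0+1},\dots,M^{(1)}_n,M^{(2)}_n)$, and for some $m_1,m_2>0$, $\|M^{(i)}_{n+1}\|\le m_i(1+\|\theta_n\|+\|w_n\|)$ almost surely for all $n\ge n_0$ and $i=1,2$. **Constants.** Let $q_1,q_2>0$ be lower bounds on the real parts of the eigenvalues of $X_1$ and $W_2$, and $K_1,K_2\ge1$ constants such that $\|e^{-X_1t}\|\le K_1e^{-q_1t}$ and $\|e^{-W_2t}\|\le K_2e^{-q_2t}$ for all $t\ge0$. Let $q_{\min}=\min\{q_1,q_2\}$, $q\in(0,q_{\min})$, $R_1^{in},R_2^{in}>0$, $R_2^{out}>R_2^{in}$, and - $R_1^{out}=R_1^{in}+\frac{4K_1\|W_1\|K_2R_2^{in}}{(q_{\min}-q)e}$, $R^*=\|X_1^{-1}\|\|b_1\|$, $R_2^w=R_2^{out}+\|W_2^{-1}\|\big[\|v_2\|+\|\Gamma_2\|(R^*+R_1^{out})\big]$, $R=1+R^*+R_1^{out}+R_2^w$;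 - $J^\theta=\|\Gamma_1\|(R^*+R_1^{out})+\|W_1\|R_2^w+\|v_1\|+m_1R$, $J^z=\|W_2\|R_2^{out}+\|W_2^{-1}\|\|\Gamma_2\|J^\theta+m_2R$; - $L_a=\frac{K_1\|W_1\|K_2R_2^{in}}{(q_{\min}-q)e}$, $L_c=\frac{K_1\|W_1\|}{q_1}$, $L_1^{md}=K_1m_1R$, $L_2^{md}=K_2m_2R$; - $L_b=\frac{K_1\|X_1\|J^\theta}{q_1}+L_1^{md}+\|X_1\|R_1^{in}+\frac{K_1\|W_1\|\|W_2\|R_2^{in}}{q_1}$; - $L^z=\|W_2\|R_2^{in}+\frac{K_2\|W_2\|J^z}{q_2}+\frac{K_2\|W_2^{-1}\|\|\Gamma_2\|J^\theta}{q_2}+L_2^{md}$; - $D_d=\max\{d^3,2\}$ (so $D_d=d^3$ for $d\ge2$ and $D_1=2$), $c_1=(16K_1^2D_d[L_1^{md}]^2)^{-1}$, $c_2=(9K_2^2D_d[L_2^{md}]^2)^{-1}$, $c_3=(64K_2^2L_c^2D_d[L_2^{md}]^2)^{-1}$. Let $a_n=\sum_{k=0}^{n-1}\alpha_k^2e^{-2q_1\sum_{i=k+1}^{n-1}\alpha_i}$,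 $b_n=\sum_{k=0}^{n-1}\beta_k^2e^{-2q_2\sum_{i=k+1}^{n-1}\beta_i}$. For $\epsilon_1,\epsilon_2>0$ let $N_0=\max\{N_a,N_b\}$ and $N_1=\max\{n_a,n_b\}$, where - $N_a=\min\Big\{N\ge0:\max\{\sup_{k\ge N}\beta_k,\sup_{k\ge N}\eta_k\}\le\frac{\min\{\epsilon_1/8,\epsilon_2/3\}}{L^z\max\{L_c,1\}}\Big\}$, $N_b=\min\{N\ge0:\sup_{k\ge N}\beta_k\le\epsilon_1/(4L_b)\}$, - $n_a=\min\{j\ge n_0:(K_1R_1^{in}+L_a)e^{-q(t_j-t_{n_0})}\le\epsilon_1/4\}$, $n_b=\min\{j\ge n_0:K_2R_2^{in}e^{-q_2(s_j-s_{n_0})}\le\epsilon_2/3\}$. **Theorem.** Let $\epsilon_1\in(0,\min\{R_1^{in},4L_a\})$, $\epsilon_2\in(0,\min\{R_2^{in},R_2^{out}-R_2^{in}\})$, $n_0\ge N_0$ and $n_1\ge N_1$. Suppose that, almost surely, $\|\theta_{n_0}-\theta^*\|\le R_1^{in}$ and $\|z_{n_0}\|\le R_2^{in}$ (in particular, $\theta_{n_0},w_{n_0}$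 may be arbitrary deterministic vectors satisfying these bounds). Then $$\Pr\{\|\theta_n-\theta^*\|\le\epsilon_1,\ \|z_n\|\le\epsilon_2\ \ \forall n\ge n_1\}\ \ge\ 1-2d^2\sum_{n\ge n_0}\Big[e^{-c_1\epsilon_1^2/a_n}+e^{-c_2\epsilon_2^2/b_n}+e^{-c_3\epsilon_1^2/b_n}\Big],$$ where $e^{-c/0}:=0$ (relevant only for $a_0=b_0=0$) and the bound is trivial if the series diverges. -/

import Mathlib

open MeasureTheory Filter Topology
open scoped ENNReal

noncomputable section

namespace TwoTS

open scoped Matrix.Norms.L2Operator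

/-- Euclidean space of dimension `d`. -/
abbrev Vec (d : ℕ) : Type := EuclideanSpace ℝ (Fin d)

/-- Real square matrices; their norm `‖A‖` is the operator norm induced by the Euclidean norm. -/
abbrev Mat (d : ℕ) : Type := Matrix (Fin d) (Fin d) ℝ

/-- The matrix-vector product on Euclidean space. -/
def app {d : ℕ} (A : Mat d) (x : Vec d) : Vec d := WithLp.toLp 2 (A.mulVec x.ofLp)

/-- Positive definite, not necessarily symmetric. -/
def IsPosDef {d : ℕ} (A : Mat d) : Prop :=
  ∀ x : Fin d → ℝ, x ≠ 0 → 0 < x ⬝ᵥ A.mulVec x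

/-- The data of the two affine maps `h_i(θ, w) = v_i - Γ_i θ - W_i w`. -/
structure System (d : ℕ) where
  v₁ : Vec d
  v₂ : Vec d
  Γ₁ : Mat d
  Γ₂ : Mat d
  W₁ : Mat d
  W₂ : Mat d

namespace System

variable {d : ℕ} (S : System d)

def h₁ (θ w : Vec d) : Vec d := S.v₁ - app S.Γ₁ θ - app S.W₁ w

def h₂ (θ w : Vec d) : Vec d := S.v₂ - app S.Γ₂ θ - app S.W₂ w

def X₁ : Mat d := S.Γ₁ - S.W₁ * S.W₂⁻¹ * S.Γ₂

def b₁ : Vec d := S.v₁ - app (S.W₁ * S.W₂⁻¹) S.v₂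

/-- `λ(θ) = W₂⁻¹ (v₂ - Γ₂ θ)`. -/
def lam (θ : Vec d) : Vec d := app S.W₂⁻¹ (S.v₂ - app S.Γ₂ θ)

/-- `θ* = X₁⁻¹ b₁`. -/
def θstar : Vec d := app S.X₁⁻¹ S.b₁

end System

/-- `q > 0` is a lower bound on the real parts of the (complex) eigenvalues of `A`, and `K ≥ 1` is
a constant for which `‖exp (-t A)‖ ≤ K exp (-q t)` for all `t ≥ 0`. -/
structure DecayBound {d : ℕ} (A : Mat d) (K q : ℝ) : Prop where
  q_pos : 0 < q
  le_re : ∀ z ∈ spectrum ℂ (A.map (fun x : ℝ => (x : ℂ))), q ≤ z.re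
  one_le : 1 ≤ K
  norm_exp_le : ∀ t : ℝ, 0 ≤ t → ‖NormedSpace.exp (-(t • A))‖ ≤ K * Real.exp (-(q * t))

/-- The scalar parameters from which all the constants are built. -/
structure Params where
  K₁ : ℝ
  K₂ : ℝ
  q₁ : ℝ
  q₂ : ℝ
  q : ℝ
  m₁ : ℝ
  m₂ : ℝ
  R₁in : ℝ
  R₂in : ℝ
  R₂out : ℝ

namespace Params

variable {d : ℕ} (P : Params) (S : System d)

def qmin : ℝ := min P.q₁ P.q₂

def R₁out : ℝ :=
  P.R₁in + 4 * P.K₁ * ‖S.W₁‖ * P.K₂ * P.R₂in / ((P.qmin - P.q) * Real.exp 1)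

end Params

/-- `R* = ‖X₁⁻¹‖ ‖b₁‖`. -/
def System.Rstar {d : ℕ} (S : System d) : ℝ := ‖S.X₁⁻¹‖ * ‖S.b₁‖

namespace Params

variable {d : ℕ} (P : Params) (S : System d)

def R₂w : ℝ :=
  P.R₂out + ‖S.W₂⁻¹‖ * (‖S.v₂‖ + ‖S.Γ₂‖ * (S.Rstar + P.R₁out S))

/-- `1 + R* + R₁out + R₂w`. -/
def Rsum : ℝ := 1 + S.Rstar + P.R₁out S + P.R₂w S

def Jθ : ℝ :=
  ‖S.Γ₁‖ * (S.Rstar + P.R₁out S) + ‖S.W₁‖ * P.R₂w S + ‖S.v₁‖ + P.m₁ * P.Rsum S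

def Jz : ℝ :=
  ‖S.W₂‖ * P.R₂out + ‖S.W₂⁻¹‖ * ‖S.Γ₂‖ * P.Jθ S + P.m₂ * P.Rsum S

def La : ℝ := P.K₁ * ‖S.W₁‖ * P.K₂ * P.R₂in * (1 / ((P.qmin - P.q) * Real.exp 1))

def Lb' : ℝ := P.K₁ * ‖S.W₁‖ * ‖S.W₂‖ * P.R₂in / P.q₁

def Lc : ℝ := P.K₁ * ‖S.W₁‖ / P.q₁

def L₁md : ℝ := P.K₁ * P.m₁ * P.Rsum S

def L₁de : ℝ := P.K₁ * ‖S.X₁‖ * P.Jθ S / P.q₁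

def Lb : ℝ := P.L₁de S + P.L₁md S + ‖S.X₁‖ * P.R₁in + P.Lb' S

def L₂md : ℝ := P.K₂ * P.m₂ * P.Rsum S

def L₂sd : ℝ := P.K₂ * (‖S.W₂⁻¹‖ * ‖S.Γ₂‖ * P.Jθ S / P.q₂)

def L₂de : ℝ := P.K₂ * (‖S.W₂‖ * P.Jz S / P.q₂)

def Lz : ℝ := ‖S.W₂‖ * P.R₂in + P.L₂de S + P.L₂sd S + P.L₂md S

/-- The dimension factor: it is `d ^ 3` for `d ≥ 2`, and `2` for `d = 1`. -/
def dimFactor (d : ℕ) : ℝ := max ((d : ℝ) ^ 3) 2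

def c₁ : ℝ := (16 * P.K₁ ^ 2 * dimFactor d * P.L₁md S ^ 2)⁻¹

def c₂ : ℝ := (9 * P.K₂ ^ 2 * dimFactor d * P.L₂md S ^ 2)⁻¹

def c₃ : ℝ := (64 * P.K₂ ^ 2 * P.Lc S ^ 2 * dimFactor d * P.L₂md S ^ 2)⁻¹

end Params

/-- `∑_{k < n} γ_k`; this is `t_n` for `γ = α` and `s_n` for `γ = β`. -/
def time (γ : ℕ → ℝ) (n : ℕ) : ℝ := ∑ k ∈ Finset.range n, γ k

/-- `∑_{k < n} γ_k² exp (-2 p ∑_{i = k+1}^{n-1} γ_i)`; this is `a_n` for `γ = α`, `p = q₁`, and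
`b_n` for `γ = β`, `p = q₂`. -/
def azumaSum (γ : ℕ → ℝ) (p : ℝ) (n : ℕ) : ℝ :=
  ∑ k ∈ Finset.range n, γ k ^ 2 * Real.exp (-2 * p * ∑ i ∈ Finset.Ico (k + 1) n, γ i)

/-- The stepsize assumption, with `η_n = α_n / β_n`. -/
structure StepsizeAssumption (α β : ℕ → ℝ) : Prop where
  α_pos : ∀ n, 0 < α n
  β_pos : ∀ n, 0 < β n
  α_sum : Tendsto (time α) atTop atTop
  β_sum : Tendsto (time β) atTop atTop
  α_le : ∀ n, α n ≤ 1
  β_le : ∀ n, β n ≤ 1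
  η_le : ∀ n, α n / β n ≤ 1
  α_lim : Tendsto α atTop (𝓝 0)
  β_lim : Tendsto β atTop (𝓝 0)
  η_lim : Tendsto (fun n => α n / β n) atTop (𝓝 0)

namespace Params

variable {d : ℕ} (P : Params) (S : System d)

def Na (ε₁ ε₂ : ℝ) (α β : ℕ → ℝ) : ℕ :=
  sInf {N : ℕ | ∀ k ≥ N,
    max (β k) (α k / β k) ≤ min (ε₁ / 8) (ε₂ / 3) / (P.Lz S * max (P.Lc S) 1)}

def Nb (ε₁ : ℝ) (β : ℕ → ℝ) : ℕ :=
  sInf {N : ℕ | ∀ k ≥ N, β k ≤ ε₁ / (4 * P.Lb S)}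

def N₀ (ε₁ ε₂ : ℝ) (α β : ℕ → ℝ) : ℕ := max (P.Na S ε₁ ε₂ α β) (P.Nb S ε₁ β)

def na (n₀ : ℕ) (ε₁ : ℝ) (α : ℕ → ℝ) : ℕ :=
  sInf {j : ℕ | n₀ ≤ j ∧
    (P.K₁ * P.R₁in + P.La S) * Real.exp (-P.q * (time α j - time α n₀)) ≤ ε₁ / 4}

def nb (n₀ : ℕ) (ε₂ : ℝ) (β : ℕ → ℝ) : ℕ :=
  sInf {j : ℕ | n₀ ≤ j ∧
    P.K₂ * P.R₂in * Real.exp (-P.q₂ * (time β j - time β n₀)) ≤ ε₂ / 3}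

def N₁ (n₀ : ℕ) (ε₁ ε₂ : ℝ) (α β : ℕ → ℝ) : ℕ := max (P.na S n₀ ε₁ α) (P.nb n₀ ε₂ β)

end Params

section Iteration

variable {d : ℕ} {Ω : Type*}

/-- The iteration, for `n ≥ n₀`. -/
def IsTwoTimescaleSA (S : System d) (α β : ℕ → ℝ) (n₀ : ℕ) (θ w M₁ M₂ : ℕ → Ω → Vec d) : Prop :=
  ∀ n ≥ n₀, ∀ ω,
    θ (n + 1) ω = θ n ω + α n • (S.h₁ (θ n ω) (w n ω) + M₁ (n + 1) ω) ∧
    w (n + 1) ω = w n ω + β n • (S.h₂ (θ n ω) (w n ω) + M₂ (n + 1) ω)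

/-- `z_n = w_n - λ(θ_n)`. -/
def zProc (S : System d) (θ w : ℕ → Ω → Vec d) (n : ℕ) (ω : Ω) : Vec d :=
  w n ω - S.lam (θ n ω)

/-- The σ-field generated by the initial values `θ_{n₀}, w_{n₀}` and by the noise up to
time `n`. -/
@[reducible] def history (n₀ : ℕ) (θ w M₁ M₂ : ℕ → Ω → Vec d) (n : ℕ) : MeasurableSpace Ω :=
  MeasurableSpace.comap (θ n₀) inferInstance ⊔ MeasurableSpace.comap (w n₀) inferInstance ⊔
    ⨆ k ∈ Set.Ioc n₀ n,
      MeasurableSpace.comap (M₁ k) inferInstance ⊔ MeasurableSpace.comap (M₂ k) inferInstance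

/-- The random variables `θ_{n₀}, w_{n₀}` and `M_{n₀+1}, M_{n₀+2}, …` are measurable, the noise
sequences are martingale differences with respect to `history`, and their norms grow at most
linearly in the iterates. -/
structure NoiseAssumption [MeasurableSpace Ω] (μ : Measure Ω) (n₀ : ℕ)
    (θ w M₁ M₂ : ℕ → Ω → Vec d) (m₁ m₂ : ℝ) : Prop where
  m₁_pos : 0 < m₁
  m₂_pos : 0 < m₂
  θ_meas : Measurable (θ n₀)
  w_meas : Measurable (w n₀)
  M₁_meas : ∀ n ≥ n₀, Measurable (M₁ (n + 1))
  M₂_meas : ∀ n ≥ n₀, Measurable (M₂ (n + 1))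
  M₁_int : ∀ n ≥ n₀, Integrable (M₁ (n + 1)) μ
  M₂_int : ∀ n ≥ n₀, Integrable (M₂ (n + 1)) μ
  M₁_condExp : ∀ n ≥ n₀, μ[M₁ (n + 1) | history n₀ θ w M₁ M₂ n] =ᵐ[μ] 0
  M₂_condExp : ∀ n ≥ n₀, μ[M₂ (n + 1) | history n₀ θ w M₁ M₂ n] =ᵐ[μ] 0
  M₁_bound : ∀ n ≥ n₀, ∀ᵐ ω ∂μ, ‖M₁ (n + 1) ω‖ ≤ m₁ * (1 + ‖θ n ω‖ + ‖w n ω‖)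
  M₂_bound : ∀ n ≥ n₀, ∀ᵐ ω ∂μ, ‖M₂ (n + 1) ω‖ ≤ m₂ * (1 + ‖θ n ω‖ + ‖w n ω‖)

end Iteration

/-- `exp (-x / a)` for `x > 0` and `a ≥ 0`, with its limit value `0` at `a = 0`. -/
def expTerm (x a : ℝ) : ℝ≥0∞ := if a = 0 then 0 else ENNReal.ofReal (Real.exp (-x / a))

end TwoTS

end

/-! With y = θ - θ* and z = w - λ(θ) the scheme decouples up to small terms: y is an Euler scheme
for y' = -X₁y - W₁z, and z one for z' = -W₂z, perturbed by the slow motion of θ, which is of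
relative size η on the fast clock. Variation of constants writes each iterate as a transient of the
linear flow, plus discretisation and coupling errors proportional to the stepsizes, plus a weighted
sum of the noise.

The pathwise half is `inBall_and_close`. Suppose the noise sums are small for as long as the
iterates have stayed in the outer balls. Then strong induction shows that the balls are never left,
because the flows of X₁ and W₂ are contractions (positive definiteness) and the errors fit between
the inner and outer radii; once the exponential transients have died out, the ε-bounds follow.

The probabilistic half bounds the noise sums. In the balls the noise is bounded, but a sample path
may leave them. Each increment is therefore multiplied by the indicator of having stayed inside so
far; this event belongs to the past, so the stopped noise is a bounded martingale difference
sequence, to which Azuma's inequality applies coordinatewise (`measure_stopped_noiseSum_gt_le`). On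
paths that have not left, stopped and original sums agree (`noiseSum_indicator_eq`), which breaks
the circularity. A union bound over n and three kinds of bad event ends the proof. -/

noncomputable section

namespace TwoTS

/-! ### Linear flows and variation of constants -/

section Flow

variable {E : Type*} [NormedAddCommGroup E] [InnerProductSpace ℝ E]

/-- The solution operator `exp (-t X)` of `y' = -X y`. -/
def flow (X : E →L[ℝ] E) (t : ℝ) : E →L[ℝ] E := NormedSpace.exp (-(t • X))

@[simp] lemma flow_zero (X : E →L[ℝ] E) : flow X 0 = 1 := by simp [flow]

lemma hasDerivAt_flow [CompleteSpace E] (X : E →L[ℝ] E) (t : ℝ) :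
    HasDerivAt (flow X) (-(flow X t * X)) t := by
  have h := hasDerivAt_exp_smul_const (𝕂 := ℝ) (-X) t
  simp only [smul_neg, mul_neg] at h
  exact h

lemma hasDerivAt_flow' [CompleteSpace E] (X : E →L[ℝ] E) (t : ℝ) :
    HasDerivAt (flow X) (-(X * flow X t)) t := by
  have h := hasDerivAt_exp_smul_const' (𝕂 := ℝ) (-X) t
  simp only [smul_neg, neg_mul] at h
  exact h

lemma continuous_flow [CompleteSpace E] (X : E →L[ℝ] E) : Continuous (flow X) :=
  continuous_iff_continuousAt.2 fun t => (hasDerivAt_flow X t).continuousAt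

lemma hasDerivAt_flow_apply [CompleteSpace E] (X : E →L[ℝ] E) (x : E) (t : ℝ) :
    HasDerivAt (fun s => flow X s x) (-(X (flow X t x))) t := by
  have h := (hasDerivAt_flow' X t).clm_apply (hasDerivAt_const t x)
  simpa using h

/-- The flow of a monotone operator is a contraction semigroup. -/
lemma norm_flow_apply_le [CompleteSpace E] {X : E →L[ℝ] E} (hX : ∀ x, 0 ≤ inner ℝ x (X x)) (x : E)
    {t : ℝ} (ht : 0 ≤ t) : ‖flow X t x‖ ≤ ‖x‖ := by
  have hd : ∀ s, HasDerivAt (fun s => ‖flow X s x‖ ^ 2)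
      (2 * inner ℝ (flow X s x) (-(X (flow X s x)))) s := fun s =>
    (hasDerivAt_flow_apply X x s).norm_sq
  have hanti : Antitone fun s => ‖flow X s x‖ ^ 2 := by
    refine antitone_of_deriv_nonpos (fun s => (hd s).differentiableAt) fun s => ?_
    rw [(hd s).deriv, inner_neg_right]
    linarith [hX (flow X s x)]
  have h := hanti ht
  simp only [flow_zero, one_apply_eq_self] at h
  exact (sq_le_sq₀ (norm_nonneg _) (norm_nonneg _)).1 h

/-- Mean value inequality: the orbit has speed at most ‖X‖‖x‖ since the flow is a contraction, so no
factor K appears. -/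
lemma norm_flow_sub_flow_le [CompleteSpace E] {X : E →L[ℝ] E} (hX : ∀ x, 0 ≤ inner ℝ x (X x)) (x : E)
    {s t : ℝ} (hs : 0 ≤ s) (hst : s ≤ t) : ‖flow X t x - flow X s x‖ ≤ ‖X‖ * ‖x‖ * (t - s) := by
  refine norm_image_sub_le_of_norm_deriv_le_segment' (f := fun s => flow X s x)
    (fun r _ => (hasDerivAt_flow_apply X x r).hasDerivWithinAt) (fun r hr => ?_) t
    (Set.right_mem_Icc.2 hst)
  rw [norm_neg]
  exact (X.le_opNorm _).trans (mul_le_mul_of_nonneg_left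
    (norm_flow_apply_le hX x (hs.trans hr.1)) (norm_nonneg _))

/-- The weight with which a force acting during `[a, b]` enters the state at time `T`. -/
def kernel (X : E →L[ℝ] E) (T a b : ℝ) : E →L[ℝ] E := ∫ τ in a..b, flow X (T - τ)

lemma continuous_flow_sub [CompleteSpace E] (X : E →L[ℝ] E) (T : ℝ) : Continuous fun τ => flow X (T - τ) :=
  (continuous_flow X).comp (continuous_const.sub continuous_id)

/-- The decay bound is weakest at the right endpoint b. This is why the exponents of `azumaSum`
start at k + 1. -/
lemma norm_kernel_le {X : E →L[ℝ] E} {K q T a b : ℝ} (hK : 0 ≤ K) (hq : 0 ≤ q)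
    (hX : ∀ t, 0 ≤ t → ‖flow X t‖ ≤ K * Real.exp (-(q * t))) (hab : a ≤ b) (hb : b ≤ T) :
    ‖kernel X T a b‖ ≤ K * Real.exp (-(q * (T - b))) * (b - a) := by
  have h := intervalIntegral.norm_integral_le_of_norm_le_const (a := a) (b := b)
    (f := fun τ => flow X (T - τ)) (C := K * Real.exp (-(q * (T - b)))) fun τ hτ => by
      rw [Set.uIoc_of_le hab] at hτ
      refine (hX _ (by linarith [hτ.2])).trans ?_
      gcongr
      exact hτ.2
  rwa [abs_of_nonneg (sub_nonneg.2 hab)] at h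

/-- Variation of constants over one step of the Euler scheme. -/
lemma flow_step [CompleteSpace E] (X : E →L[ℝ] E) (T a b : ℝ) (x f n : E) :
    flow X (T - b) (x + (b - a) • (-(X x) + f + n)) =
      flow X (T - a) x + kernel X T a b n +
        ∫ τ in a..b, flow X (T - τ) (f + (τ - a) • X (-(X x) + f + n)) := by
  set g := -(X x) + f + n with hg
  -- The state is interpolated linearly with slope g. Differentiating the flow produces X x + (τ -
  -- a) X g; its first part cancels the linear drift in g, and what is left is the forcing, the
  -- noise and the discretisation error.
  have hd : ∀ τ, HasDerivAt (fun τ => flow X (T - τ) (x + (τ - a) • g))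
      (flow X (T - τ) n + flow X (T - τ) (f + (τ - a) • X g)) τ := by
    intro τ
    have h1 : HasDerivAt (fun τ => flow X (T - τ)) (flow X (T - τ) * X) τ := by
      have := (hasDerivAt_flow X (T - τ)).scomp τ ((hasDerivAt_id τ).const_sub T)
      simpa [Function.comp_def] using this
    have h2 : HasDerivAt (fun τ => x + (τ - a) • g) g τ := by
      have := (((hasDerivAt_id τ).sub_const a).smul_const g).const_add x
      simpa using this
    have h3 := h1.clm_apply h2
    refine h3.congr_deriv ?_
    rw [mul_apply_eq_comp, ← map_add, ← map_add]
    congr 1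
    rw [map_add, map_smul, add_right_comm, show X x + g = n + f by rw [hg]; abel, add_assoc]
  have hc1 : Continuous fun τ => flow X (T - τ) n := (continuous_flow_sub X T).clm_apply
    continuous_const
  have hc2 : Continuous fun τ => flow X (T - τ) (f + (τ - a) • X g) :=
    (continuous_flow_sub X T).clm_apply (by fun_prop)
  have h := intervalIntegral.integral_eq_sub_of_hasDerivAt (a := a) (b := b)
    (fun τ _ => hd τ) ((hc1.add hc2).intervalIntegrable a b)
  rw [intervalIntegral.integral_add (hc1.intervalIntegrable a b) (hc2.intervalIntegrable a b)] at h
  have hk : kernel X T a b n = ∫ τ in a..b, flow X (T - τ) n :=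
    ContinuousLinearMap.intervalIntegral_apply
      ((continuous_flow_sub X T).intervalIntegrable a b) n
  rw [hk, add_assoc, h]
  simp

/-- The accumulated effect at step `n` of the noise `N` acting from step `m` on. -/
def noiseSum (X : E →L[ℝ] E) (γ : ℕ → ℝ) (m n : ℕ) (N : ℕ → E) : E :=
  ∑ k ∈ Finset.Ico m n, kernel X (time γ n) (time γ k) (time γ (k + 1)) (N k)

lemma time_succ (γ : ℕ → ℝ) (n : ℕ) : time γ (n + 1) = time γ n + γ n :=
  Finset.sum_range_succ _ _

lemma time_mono {γ : ℕ → ℝ} (hγ : ∀ n, 0 < γ n) : Monotone (time γ) :=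
  monotone_nat_of_le_succ fun n => by rw [time_succ]; linarith [hγ n]

/-- Variation of constants for the Euler scheme `y_{k+1} = y_k + γ_k (-X y_k + f_k + N_k)`. -/
lemma variation_of_constants [CompleteSpace E] (X : E →L[ℝ] E) {γ : ℕ → ℝ} {m n : ℕ} (hmn : m ≤ n)
    {y f N : ℕ → E}
    (hy : ∀ k ∈ Finset.Ico m n, y (k + 1) = y k + γ k • (-(X (y k)) + f k + N k)) :
    y n = flow X (time γ n - time γ m) (y m) + noiseSum X γ m n N +
      ∑ k ∈ Finset.Ico m n, ∫ τ in (time γ k)..(time γ (k + 1)),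
        flow X (time γ n - τ) (f k + (τ - time γ k) • X (-(X (y k)) + f k + N k)) := by
  have htel := Finset.sum_Ico_sub (fun k => flow X (time γ n - time γ k) (y k)) hmn
  simp only [sub_self, flow_zero, one_apply_eq_self] at htel
  rw [noiseSum, add_assoc, ← Finset.sum_add_distrib, ← sub_eq_iff_eq_add', ← htel]
  refine Finset.sum_congr rfl fun k hk => ?_
  have h := flow_step X (time γ n) (time γ k) (time γ (k + 1)) (y k) (f k) (N k)
  rw [show time γ (k + 1) - time γ k = γ k by rw [time_succ]; ring, ← hy k hk] at h
  rw [h]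
  abel

lemma integral_exp_le {q a T : ℝ} (hq : 0 < q) :
    ∫ τ in a..T, Real.exp (-(q * (T - τ))) ≤ 1 / q := by
  have hd : ∀ τ, HasDerivAt (fun τ => Real.exp (-(q * (T - τ))) / q)
      (Real.exp (-(q * (T - τ)))) τ := by
    intro τ
    have h := ((((hasDerivAt_id τ).const_sub T).const_mul q).neg.exp).div_const q
    refine h.congr_deriv ?_
    change Real.exp (-(q * (T - τ))) * -(q * -1) / q = _
    field_simp
  rw [intervalIntegral.integral_eq_sub_of_hasDerivAt (fun τ _ => hd τ)
    (Continuous.intervalIntegrable (by fun_prop) _ _)]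
  have : 0 ≤ Real.exp (-(q * (T - a))) / q := by positivity
  simp only [sub_self, mul_zero, neg_zero, Real.exp_zero]
  linarith

/-- From 1 + u ≤ exp u at u = δx - 1; equality holds at x = 1/δ. The factor e in the constants comes
from here. -/
lemma mul_exp_neg_le {δ x : ℝ} (hδ : 0 < δ) : x * Real.exp (-(δ * x)) ≤ 1 / (δ * Real.exp 1) := by
  have h : δ * x ≤ Real.exp (δ * x - 1) := by linarith [Real.add_one_le_exp (δ * x - 1)]
  rw [Real.exp_sub, le_div_iff₀ (Real.exp_pos 1)] at h
  rw [le_div_iff₀ (by positivity), Real.exp_neg, mul_comm x, ← div_eq_inv_mul, div_mul_eq_mul_div,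
    div_le_one (Real.exp_pos _)]
  linarith

/-- Replacing both rates by the smaller one makes the integrand constant; the resulting factor T - a
is absorbed by lowering the rate to r. Hence the requirement q < q_min. -/
lemma integral_exp_mul_exp_le {q p r a T : ℝ} (hr : r < min q p) (haT : a ≤ T) :
    ∫ τ in a..T, Real.exp (-(q * (T - τ))) * Real.exp (-(p * (τ - a))) ≤
      1 / ((min q p - r) * Real.exp 1) * Real.exp (-(r * (T - a))) := by
  have h1 : ∫ τ in a..T, Real.exp (-(q * (T - τ))) * Real.exp (-(p * (τ - a))) ≤
      ∫ _τ in a..T, Real.exp (-(min q p * (T - a))) := by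
    refine intervalIntegral.integral_mono_on haT
      (Continuous.intervalIntegrable (by fun_prop) _ _)
      (Continuous.intervalIntegrable (by fun_prop) _ _) fun τ hτ => ?_
    rw [← Real.exp_add, Real.exp_le_exp]
    have := mul_le_mul_of_nonneg_right (min_le_left q p) (sub_nonneg.2 hτ.2)
    have := mul_le_mul_of_nonneg_right (min_le_right q p) (sub_nonneg.2 hτ.1)
    nlinarith
  refine h1.trans ?_
  rw [intervalIntegral.integral_const, smul_eq_mul]
  have h2 := mul_exp_neg_le (x := T - a) (sub_pos.2 hr)
  calc (T - a) * Real.exp (-(min q p * (T - a)))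
      = (T - a) * Real.exp (-((min q p - r) * (T - a))) * Real.exp (-(r * (T - a))) := by
        rw [mul_assoc, ← Real.exp_add]; ring_nf
    _ ≤ _ := mul_le_mul_of_nonneg_right h2 (Real.exp_pos _).le

/-- Bound for the accumulated effect of a force `‖f_k(τ)‖ ≤ B + C exp (-p (τ - t_m))`. -/
lemma norm_sum_integral_le {X : E →L[ℝ] E} {K q p r B C : ℝ} (hK : 0 ≤ K) (hq : 0 < q)
    (hX : ∀ t, 0 ≤ t → ‖flow X t‖ ≤ K * Real.exp (-(q * t))) (hB : 0 ≤ B) (hC : 0 ≤ C)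
    (hr : r < min q p)
    {γ : ℕ → ℝ} (hγ : ∀ n, 0 < γ n) {m n : ℕ} (hmn : m ≤ n) {f : ℕ → ℝ → E}
    (hf : ∀ k ∈ Finset.Ico m n, ∀ τ ∈ Set.Icc (time γ k) (time γ (k + 1)),
      ‖f k τ‖ ≤ B + C * Real.exp (-(p * (τ - time γ m)))) :
    ‖∑ k ∈ Finset.Ico m n, ∫ τ in (time γ k)..(time γ (k + 1)), flow X (time γ n - τ) (f k τ)‖ ≤
      K / q * B + K * C * (1 / ((min q p - r) * Real.exp 1)) *
        Real.exp (-(r * (time γ n - time γ m))) := by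
  have hmono := time_mono hγ
  set T := time γ n
  set a := time γ m
  let G : ℝ → ℝ := fun τ => K * B * Real.exp (-(q * (T - τ))) +
    K * C * (Real.exp (-(q * (T - τ))) * Real.exp (-(p * (τ - a))))
  have hG : Continuous G := by fun_prop
  have hstep : ∀ k ∈ Finset.Ico m n,
      ‖∫ τ in (time γ k)..(time γ (k + 1)), flow X (T - τ) (f k τ)‖ ≤
        ∫ τ in (time γ k)..(time γ (k + 1)), G τ := by
    intro k hk
    refine intervalIntegral.norm_integral_le_of_norm_le (hmono (Nat.le_succ k))
      (Eventually.of_forall fun τ hτ => ?_) (hG.intervalIntegrable _ _)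
    have hk' := Finset.mem_Ico.1 hk
    have hτT : 0 ≤ T - τ := sub_nonneg.2 (hτ.2.trans (hmono hk'.2))
    calc ‖flow X (T - τ) (f k τ)‖ ≤ ‖flow X (T - τ)‖ * ‖f k τ‖ := ContinuousLinearMap.le_opNorm _ _
      _ ≤ K * Real.exp (-(q * (T - τ))) * (B + C * Real.exp (-(p * (τ - a)))) :=
        mul_le_mul (hX _ hτT) (hf k hk τ ⟨hτ.1.le, hτ.2⟩) (norm_nonneg _) (by positivity)
      _ = G τ := by simp only [G]; ring
  calc _ ≤ ∑ k ∈ Finset.Ico m n, ∫ τ in (time γ k)..(time γ (k + 1)), G τ :=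
        norm_sum_le_of_le _ hstep
    _ = ∫ τ in a..T, G τ := intervalIntegral.sum_integral_adjacent_intervals_Ico hmn
        fun k _ => hG.intervalIntegrable _ _
    _ = K * B * (∫ τ in a..T, Real.exp (-(q * (T - τ)))) +
        K * C * ∫ τ in a..T, Real.exp (-(q * (T - τ))) * Real.exp (-(p * (τ - a))) := by
      simp only [G]
      rw [intervalIntegral.integral_add, intervalIntegral.integral_const_mul,
        intervalIntegral.integral_const_mul]
      all_goals exact Continuous.intervalIntegrable (by fun_prop) _ _
    _ ≤ K * B * (1 / q) + K * C * (1 / ((min q p - r) * Real.exp 1) * Real.exp (-(r * (T - a)))) :=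
      add_le_add (mul_le_mul_of_nonneg_left (integral_exp_le hq) (by positivity))
        (mul_le_mul_of_nonneg_left (integral_exp_mul_exp_le hr (hmono hmn)) (by positivity))
    _ = _ := by ring

end Flow

/-! ### Azuma's inequality for scalar and vector martingale differences -/

section Azuma

variable {Ω : Type*} [mΩ : MeasurableSpace Ω] {μ : Measure Ω} [IsProbabilityMeasure μ]

lemma exp_mul_le_cosh_add {c x l : ℝ} (hc : 0 < c) (hx : |x| ≤ c) :
    Real.exp (l * x) ≤ Real.cosh (l * c) + Real.sinh (l * c) / c * x := by
  have h1 : 0 ≤ (c + x) / (2 * c) := div_nonneg (by linarith [(abs_le.1 hx).1]) (by positivity)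
  have h2 : 0 ≤ (c - x) / (2 * c) := div_nonneg (by linarith [(abs_le.1 hx).2]) (by positivity)
  have h := convexOn_exp.2 (Set.mem_univ (l * c)) (Set.mem_univ (-(l * c))) h1 h2
    (by field_simp; ring)
  simp only [smul_eq_mul] at h
  rw [show (c + x) / (2 * c) * (l * c) + (c - x) / (2 * c) * -(l * c) = l * x by
    field_simp; ring] at h
  refine h.trans (le_of_eq ?_)
  rw [Real.cosh_eq, Real.sinh_eq]
  field_simp
  ring

lemma integral_mul_eq_zero_of_condExp_eq_zero {F : MeasurableSpace Ω} (hF : F ≤ mΩ)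
    {Y X : Ω → ℝ} (hY : StronglyMeasurable[F] Y) {C : ℝ} (hYb : ∀ᵐ ω ∂μ, ‖Y ω‖ ≤ C)
    (hX : Integrable X μ) (hXF : μ[X | F] =ᵐ[μ] 0) : ∫ ω, Y ω * X ω ∂μ = 0 := by
  have h := condExp_stronglyMeasurable_mul_of_bound hF hY hX C hYb
  rw [← integral_condExp hF]
  refine integral_eq_zero_of_ae ?_
  filter_upwards [h, hXF] with ω h1 h2
  simp only [Pi.mul_def] at h1
  rw [h1, h2]
  simp

/-- The partial sums of bounded martingale differences are sub-Gaussian. -/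
lemma hasSubgaussianMGF_sum {F : ℕ → MeasurableSpace Ω} (hF : ∀ n, F n ≤ mΩ) (hmono : Monotone F)
    {X : ℕ → Ω → ℝ} {m : ℕ} {c : ℕ → NNReal} {n : ℕ}
    (hX : ∀ k ∈ Finset.Ico m n, StronglyMeasurable[F (k + 1)] (X k))
    (hb : ∀ k ∈ Finset.Ico m n, ∀ᵐ ω ∂μ, |X k ω| ≤ c k)
    (hc : ∀ k ∈ Finset.Ico m n, 0 < c k)
    (hce : ∀ k ∈ Finset.Ico m n, μ[X k | F k] =ᵐ[μ] 0) :
    ProbabilityTheory.HasSubgaussianMGF (fun ω => ∑ k ∈ Finset.Ico m n, X k ω)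
      (∑ k ∈ Finset.Ico m n, c k ^ 2) μ := by
  rcases lt_or_ge n m with hnm | hmn
  · simp [Finset.Ico_eq_empty_of_le hnm.le, ProbabilityTheory.HasSubgaussianMGF.fun_zero]
  induction n, hmn using Nat.le_induction with
  | base => simp [ProbabilityTheory.HasSubgaussianMGF.fun_zero]
  | succ n hmn ih =>
    have hsub : ∀ k ∈ Finset.Ico m n, k ∈ Finset.Ico m (n + 1) := fun k hk =>
      Finset.Ico_subset_Ico_right (Nat.le_succ n) hk
    have hn : n ∈ Finset.Ico m (n + 1) := Finset.mem_Ico.2 ⟨hmn, Nat.lt_succ_self n⟩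
    specialize ih (fun k hk => hX k (hsub k hk)) (fun k hk => hb k (hsub k hk))
      (fun k hk => hc k (hsub k hk)) (fun k hk => hce k (hsub k hk))
    set S : Ω → ℝ := fun ω => ∑ k ∈ Finset.Ico m n, X k ω with hS
    have hSm : StronglyMeasurable[F n] S := by
      refine Finset.stronglyMeasurable_fun_sum _ fun k hk => (hX k (hsub k hk)).mono ?_
      exact hmono (Finset.mem_Ico.1 hk).2
    obtain ⟨B, hB⟩ : ∃ B : ℝ, ∀ᵐ ω ∂μ, |S ω| ≤ B := by
      refine ⟨∑ k ∈ Finset.Ico m n, (c k : ℝ), ?_⟩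
      filter_upwards [(ae_ball_iff (Finset.countable_toSet _)).2
        fun k hk => hb k (hsub k hk)] with ω hω
      exact (Finset.abs_sum_le_sum_abs _ _).trans (Finset.sum_le_sum fun k hk => hω k hk)
    have hcn : (0 : ℝ) < c n := hc n hn
    have hXm : StronglyMeasurable[F (n + 1)] (X n) := hX n hn
    have hXi : Integrable (X n) μ := Integrable.of_bound
      (hXm.mono (hF _)).aestronglyMeasurable (c n) (hb n hn)
    have hEm : ∀ l : ℝ, StronglyMeasurable[F n] fun ω => Real.exp (l * S ω) := fun l =>
      Real.continuous_exp.comp_stronglyMeasurable (hSm.const_mul l)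
    have hEb : ∀ l : ℝ, ∀ᵐ ω ∂μ, ‖Real.exp (l * S ω)‖ ≤ Real.exp (|l| * B) := by
      intro l
      filter_upwards [hB] with ω hω
      rw [Real.norm_eq_abs, Real.abs_exp, Real.exp_le_exp]
      calc l * S ω ≤ |l * S ω| := le_abs_self _
        _ = |l| * |S ω| := abs_mul _ _
        _ ≤ _ := mul_le_mul_of_nonneg_left hω (abs_nonneg _)
    -- The exponential lies below its chord over [-c, c]: the bound is affine in the new increment.
    have hle : ∀ l : ℝ, ∀ᵐ ω ∂μ, Real.exp (l * (S ω + X n ω)) ≤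
        Real.cosh (l * c n) * Real.exp (l * S ω) +
          Real.sinh (l * c n) / c n * (Real.exp (l * S ω) * X n ω) := by
      intro l
      filter_upwards [hb n hn] with ω hω
      rw [mul_add, Real.exp_add]
      have := mul_le_mul_of_nonneg_left (exp_mul_le_cosh_add (l := l) hcn hω)
        (Real.exp_pos (l * S ω)).le
      linarith
    have hEXi : ∀ l : ℝ, Integrable (fun ω => Real.exp (l * S ω) * X n ω) μ := fun l =>
      hXi.bdd_mul ((hEm l).mono (hF n)).aestronglyMeasurable (hEb l)
    have hri : ∀ l : ℝ, Integrable (fun ω => Real.cosh (l * c n) * Real.exp (l * S ω) +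
          Real.sinh (l * c n) / c n * (Real.exp (l * S ω) * X n ω)) μ := fun l =>
      ((ih.integrable_exp_mul l).const_mul _).add ((hEXi l).const_mul _)
    have hli : ∀ l : ℝ, Integrable (fun ω => Real.exp (l * (S ω + X n ω))) μ := by
      intro l
      refine (hri l).mono' ?_ ?_
      · exact (Real.continuous_exp.comp_stronglyMeasurable
          (((hSm.mono (hF n)).add (hXm.mono (hF _))).const_mul l)).aestronglyMeasurable
      · filter_upwards [hle l] with ω hω
        rwa [Real.norm_eq_abs, Real.abs_exp]
    simp only [Finset.sum_Ico_succ_top hmn]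
    refine ⟨hli, fun l => ?_⟩
    -- The sinh term vanishes in the mean, since exp (l S) is bounded and known at time n. Only cosh
    -- (l c) ≤ exp ((l c)² / 2) remains.
    have h0 := integral_mul_eq_zero_of_condExp_eq_zero (hF n) (hEm l) (hEb l) hXi (hce n hn)
    calc ProbabilityTheory.mgf (fun ω => S ω + X n ω) μ l
        ≤ ∫ ω, (Real.cosh (l * c n) * Real.exp (l * S ω) +
          Real.sinh (l * c n) / c n * (Real.exp (l * S ω) * X n ω)) ∂μ :=
        integral_mono_ae (hli l) (hri l) (hle l)
      _ = Real.cosh (l * c n) * ProbabilityTheory.mgf S μ l := by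
        rw [integral_add ((ih.integrable_exp_mul l).const_mul _) ((hEXi l).const_mul _),
          integral_const_mul, integral_const_mul, h0, mul_zero, add_zero]
        rfl
      _ ≤ Real.exp ((l * c n) ^ 2 / 2) *
          Real.exp ((∑ k ∈ Finset.Ico m n, c k ^ 2 : NNReal) * l ^ 2 / 2) :=
        mul_le_mul (Real.cosh_le_exp_half_sq _) (ih.mgf_le l) ProbabilityTheory.mgf_nonneg
          (Real.exp_pos _).le
      _ = _ := by
        rw [← Real.exp_add]
        push_cast
        ring_nf

lemma measure_abs_ge_le {S : Ω → ℝ} {v : NNReal} (h : ProbabilityTheory.HasSubgaussianMGF S v μ)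
    {t V : ℝ} (ht : 0 ≤ t) (hv : 0 < v) (hV : v ≤ V) :
    μ {ω | t ≤ |S ω|} ≤ 2 * ENNReal.ofReal (Real.exp (-t ^ 2 / (2 * V))) := by
  have hexp : Real.exp (-t ^ 2 / (2 * v)) ≤ Real.exp (-t ^ 2 / (2 * V)) := by
    have hv' : (0 : ℝ) < v := hv
    rw [Real.exp_le_exp, neg_div, neg_div, neg_le_neg_iff]
    gcongr
  have key : ∀ {S' : Ω → ℝ}, ProbabilityTheory.HasSubgaussianMGF S' v μ →
      μ {ω | t ≤ S' ω} ≤ ENNReal.ofReal (Real.exp (-t ^ 2 / (2 * V))) := by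
    intro S' h'
    rw [← ofReal_measureReal]
    exact ENNReal.ofReal_le_ofReal ((h'.measure_ge_le ht).trans hexp)
  calc μ {ω | t ≤ |S ω|} ≤ μ ({ω | t ≤ S ω} ∪ {ω | t ≤ (-S) ω}) :=
        measure_mono fun ω (hω : t ≤ |S ω|) => le_abs.1 hω
    _ ≤ _ := (measure_union_le _ _).trans (add_le_add (key h) (key h.neg))
    _ = _ := (two_mul _).symm

lemma exists_coord_of_lt_norm {d : ℕ} {x : Vec d} {t : ℝ} (ht : 0 ≤ t) (hx : t < ‖x‖) :
    ∃ i, t / √d ≤ |x i| := by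
  by_contra! hcon
  have hd : 0 < d := by
    rcases Nat.eq_zero_or_pos d with rfl | h
    · rw [Subsingleton.elim x 0, norm_zero] at hx
      linarith
    · exact h
  have h1 : ‖x‖ ^ 2 ≤ t ^ 2 := by
    rw [EuclideanSpace.real_norm_sq_eq]
    calc ∑ i, x i ^ 2 ≤ ∑ _i : Fin d, t ^ 2 / d := Finset.sum_le_sum fun i _ => by
          have := pow_le_pow_left₀ (abs_nonneg _) (hcon i).le 2
          rwa [sq_abs, div_pow, Real.sq_sqrt (Nat.cast_nonneg d)] at this
      _ = t ^ 2 := by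
          have : (d : ℝ) ≠ 0 := by positivity
          simp
          field_simp
  exact absurd hx (not_lt.2 ((sq_le_sq₀ (norm_nonneg _) ht).1 h1))

/-- Azuma's inequality for a sum of linear images of bounded vector martingale differences. -/
lemma measure_norm_sum_gt_le {d : ℕ} {F : ℕ → MeasurableSpace Ω} (hF : ∀ n, F n ≤ mΩ)
    (hmono : Monotone F) {N : ℕ → Ω → Vec d} {m n : ℕ} (hmn : m < n)
    (hN : ∀ k ≥ m, StronglyMeasurable[F (k + 1)] (N k)) {R : ℝ}
    (hb : ∀ k ≥ m, ∀ᵐ ω ∂μ, ‖N k ω‖ ≤ R)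
    (hce : ∀ k ≥ m, μ[N k | F k] =ᵐ[μ] 0)
    {A : ℕ → Vec d →L[ℝ] Vec d} {c : ℕ → ℝ} (hc : ∀ k, 0 < c k)
    (hA : ∀ k ∈ Finset.Ico m n, ‖A k‖ * R ≤ c k) {t V : ℝ} (ht : 0 ≤ t)
    (hV : ∑ k ∈ Finset.Ico m n, c k ^ 2 ≤ V) :
    μ {ω | t < ‖∑ k ∈ Finset.Ico m n, A k (N k ω)‖} ≤
      2 * d * ENNReal.ofReal (Real.exp (-t ^ 2 / (2 * d * V))) := by
  have hcoord : ∀ i : Fin d, μ {ω | t / √d ≤ |(∑ k ∈ Finset.Ico m n, A k (N k ω)) i|} ≤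
      2 * ENNReal.ofReal (Real.exp (-t ^ 2 / (2 * d * V))) := by
    intro i
    have hsum : ∀ ω, (∑ k ∈ Finset.Ico m n, A k (N k ω)) i =
        ∑ k ∈ Finset.Ico m n, ((EuclideanSpace.proj i : Vec d →L[ℝ] ℝ).comp (A k)) (N k ω) := by
      intro ω
      simp
    have hint : ∀ k ∈ Finset.Ico m n, Integrable (N k) μ := fun k hk => Integrable.of_bound
      ((hN k (Finset.mem_Ico.1 hk).1).mono (hF _)).aestronglyMeasurable R
      (hb k (Finset.mem_Ico.1 hk).1)
    have hsg := hasSubgaussianMGF_sum (μ := μ) hF hmono (m := m) (n := n)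
      (X := fun k ω => ((EuclideanSpace.proj i : Vec d →L[ℝ] ℝ).comp (A k)) (N k ω))
      (c := fun k => ⟨c k, (hc k).le⟩)
      (fun k hk => (ContinuousLinearMap.continuous _).comp_stronglyMeasurable
        (hN k (Finset.mem_Ico.1 hk).1))
      (fun k hk => by
        filter_upwards [hb k (Finset.mem_Ico.1 hk).1] with ω hω
        refine le_trans ?_ (hA k hk)
        calc |(A k (N k ω)) i| ≤ ‖A k (N k ω)‖ := by
              simpa only [Real.norm_eq_abs] using PiLp.norm_apply_le (A k (N k ω)) i
          _ ≤ ‖A k‖ * ‖N k ω‖ := ContinuousLinearMap.le_opNorm _ _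
          _ ≤ _ := mul_le_mul_of_nonneg_left hω (norm_nonneg _))
      (fun k _ => hc k)
      (fun k hk => by
        have h := ContinuousLinearMap.comp_condExp_comm (m := F k) (hint k hk)
          ((EuclideanSpace.proj i : Vec d →L[ℝ] ℝ).comp (A k))
        filter_upwards [h, hce k (Finset.mem_Ico.1 hk).1] with ω h1 h2
        refine h1.symm.trans ?_
        rw [Function.comp_apply, h2]
        simp)
    simp only [hsum]
    have hdR : (0 : ℝ) < d := by exact_mod_cast i.pos
    refine (measure_abs_ge_le hsg (t := t / √d) (V := V) (by positivity) ?_ ?_).trans_eq ?_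
    -- The tail lemma needs a positive variance proxy, which m < n ensures.
    · exact Finset.sum_pos (fun k _ => pow_pos (show (0 : NNReal) < ⟨c k, _⟩ from hc k) 2)
        ⟨m, Finset.mem_Ico.2 ⟨le_rfl, hmn⟩⟩
    · push_cast
      exact hV
    · congr 3
      rw [div_pow, Real.sq_sqrt hdR.le]
      field_simp
  calc μ {ω | t < ‖∑ k ∈ Finset.Ico m n, A k (N k ω)‖}
      ≤ μ (⋃ i : Fin d, {ω | t / √d ≤ |(∑ k ∈ Finset.Ico m n, A k (N k ω)) i|}) :=
        measure_mono fun ω hω => Set.mem_iUnion.2 (exists_coord_of_lt_norm ht hω)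
    _ ≤ ∑ i : Fin d, μ {ω | t / √d ≤ |(∑ k ∈ Finset.Ico m n, A k (N k ω)) i|} :=
        measure_iUnion_fintype_le _ _
    _ ≤ ∑ _i : Fin d, 2 * ENNReal.ofReal (Real.exp (-t ^ 2 / (2 * d * V))) :=
        Finset.sum_le_sum fun i _ => hcoord i
    _ = _ := by simp; ring

end Azuma

/-! ### Comparison of the two iterates with their linear flows -/

section Deterministic

variable {E : Type*} [NormedAddCommGroup E] [InnerProductSpace ℝ E] [CompleteSpace E]

/-- The fast iterate stays close to the flow of its linear part. -/
lemma norm_fast_sub_flow_le {W D : E →L[ℝ] E} {K q : ℝ} (hK : 0 ≤ K) (hq : 0 < q)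
    (hW : ∀ t, 0 ≤ t → ‖flow W t‖ ≤ K * Real.exp (-(q * t)))
    {α β : ℕ → ℝ} (hβ : ∀ n, 0 < β n) {m n : ℕ} (hmn : m ≤ n)
    {y z N : ℕ → E} {Jy Jz δ : ℝ} (hJy : 0 ≤ Jy) (hJz : 0 ≤ Jz) (hδ : 0 ≤ δ)
    (hz : ∀ k ∈ Finset.Ico m n,
      z (k + 1) = z k + β k • (-(W (z k)) + N k) + D (y (k + 1) - y k))
    (hyJ : ∀ k ∈ Finset.Ico m n, ‖y (k + 1) - y k‖ ≤ α k * Jy)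
    (hzJ : ∀ k ∈ Finset.Ico m n, ‖z (k + 1) - z k‖ ≤ β k * Jz)
    (hβδ : ∀ k ∈ Finset.Ico m n, β k ≤ δ) (hηδ : ∀ k ∈ Finset.Ico m n, α k / β k ≤ δ) :
    ‖z n - flow W (time β n - time β m) (z m)‖ ≤
      K / q * ((‖W‖ * Jz + ‖D‖ * Jy) * δ) + ‖noiseSum W β m n N‖ := by
  -- Dividing the coupling term by β makes it a force on the fast clock, of size at most ‖D‖ Jy α /
  -- β.
  set f : ℕ → E := fun k => (β k)⁻¹ • D (y (k + 1) - y k) with hf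
  have hg : ∀ k ∈ Finset.Ico m n,
      -(W (z k)) + f k + N k = (β k)⁻¹ • (z (k + 1) - z k) := by
    intro k hk
    have hb : β k ≠ 0 := (hβ k).ne'
    rw [hz k hk, add_assoc (z k), add_sub_cancel_left, smul_add, smul_smul, inv_mul_cancel₀ hb, one_smul]
    abel
  have hstep : ∀ k ∈ Finset.Ico m n, z (k + 1) = z k + β k • (-(W (z k)) + f k + N k) := by
    intro k hk
    rw [hg k hk, smul_smul, mul_inv_cancel₀ (hβ k).ne', one_smul, add_sub_cancel]
  rw [variation_of_constants W hmn hstep]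
  -- No decaying force acts here (C = 0), so p and r are dummies that only have to satisfy r < min q
  -- p.
  have hbound := norm_sum_integral_le (X := W) (K := K) (q := q) (p := q) (r := q - 1)
    (B := (‖W‖ * Jz + ‖D‖ * Jy) * δ) (C := 0) hK hq hW (by positivity) le_rfl (by simp) hβ hmn
    (f := fun k τ => f k + (τ - time β k) • W (-(W (z k)) + f k + N k)) (by
      intro k hk τ hτ
      have hb := hβ k
      have hτ0 : 0 ≤ τ - time β k := sub_nonneg.2 hτ.1
      have hτ1 : τ - time β k ≤ δ := by
        have := hτ.2
        rw [time_succ] at this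
        linarith [hβδ k hk]
      have h1 : ‖f k‖ ≤ ‖D‖ * Jy * δ := by
        rw [hf, norm_smul, norm_inv, Real.norm_of_nonneg hb.le]
        calc (β k)⁻¹ * ‖D (y (k + 1) - y k)‖ ≤ (β k)⁻¹ * (‖D‖ * (α k * Jy)) := by
              gcongr
              exact (D.le_opNorm _).trans (mul_le_mul_of_nonneg_left (hyJ k hk) (norm_nonneg _))
          _ = ‖D‖ * Jy * (α k / β k) := by ring
          _ ≤ _ := mul_le_mul_of_nonneg_left (hηδ k hk) (by positivity)
      have h2 : ‖-(W (z k)) + f k + N k‖ ≤ Jz := by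
        rw [hg k hk, norm_smul, norm_inv, Real.norm_of_nonneg hb.le, inv_mul_le_iff₀ hb]
        exact hzJ k hk
      have h3 : ‖(τ - time β k) • W (-(W (z k)) + f k + N k)‖ ≤ δ * (‖W‖ * Jz) := by
        rw [norm_smul, Real.norm_of_nonneg hτ0]
        exact mul_le_mul hτ1 ((W.le_opNorm _).trans (mul_le_mul_of_nonneg_left h2 (norm_nonneg _)))
          (norm_nonneg _) hδ
      rw [zero_mul, add_zero]
      linarith [norm_add_le (f k) ((τ - time β k) • W (-(W (z k)) + f k + N k))])
  simp only [mul_zero, zero_mul, add_zero] at hbound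
  rw [add_assoc, add_sub_cancel_left]
  refine (norm_add_le _ _).trans ?_
  linarith

/-- The slow iterate stays close to the flow of its linear part, if the fast one does. -/
lemma norm_slow_sub_flow_le {X W B : E →L[ℝ] E} {K₁ q₁ K₂ q₂ r : ℝ} (hK₁ : 0 ≤ K₁) (hq₁ : 0 < q₁)
    (hX : ∀ t, 0 ≤ t → ‖flow X t‖ ≤ K₁ * Real.exp (-(q₁ * t)))
    (hK₂ : 0 ≤ K₂) (hq₂ : 0 < q₂)
    (hW : ∀ t, 0 ≤ t → ‖flow W t‖ ≤ K₂ * Real.exp (-(q₂ * t)))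
    (hWmono : ∀ x, 0 ≤ inner ℝ x (W x)) (hr : r < min q₁ q₂)
    {α β : ℕ → ℝ} (hα : ∀ n, 0 < α n) (hαβ : ∀ n, α n ≤ β n) {m n : ℕ} (hmn : m ≤ n)
    {y z N : ℕ → E} {J ρ e δ : ℝ} (hJ : 0 ≤ J) (he : 0 ≤ e) (hδ : 0 ≤ δ)
    (hy : ∀ k ∈ Finset.Ico m n, y (k + 1) = y k + α k • (-(X (y k)) - B (z k) + N k))
    (hyJ : ∀ k ∈ Finset.Ico m n, ‖y (k + 1) - y k‖ ≤ α k * J)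
    (hze : ∀ k ∈ Finset.Ico m n, ‖z k - flow W (time β k - time β m) (z m)‖ ≤ e)
    (hρ : ‖z m‖ ≤ ρ) (hαδ : ∀ k ∈ Finset.Ico m n, α k ≤ δ) :
    ‖y n - flow X (time α n - time α m) (y m)‖ ≤
      K₁ / q₁ * ((‖X‖ * J + ‖B‖ * ‖W‖ * ρ) * δ + ‖B‖ * e) +
        K₁ * (‖B‖ * K₂ * ρ) * (1 / ((min q₁ q₂ - r) * Real.exp 1)) *
          Real.exp (-(r * (time α n - time α m))) + ‖noiseSum X α m n N‖ := by
  have hρ0 : 0 ≤ ρ := (norm_nonneg _).trans hρ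
  have hβ : ∀ n, 0 < β n := fun n => (hα n).trans_le (hαβ n)
  set f : ℕ → E := fun k => -(B (z k)) with hf
  have hstep : ∀ k ∈ Finset.Ico m n, y (k + 1) = y k + α k • (-(X (y k)) + f k + N k) := by
    intro k hk
    rw [hy k hk, sub_eq_add_neg]
  -- Since α ≤ β, the fast clock is ahead of the slow one, so decay in fast time implies decay in
  -- slow time.
  have htime : ∀ k, m ≤ k → time α k - time α m ≤ time β k - time β m := by
    intro k hk
    rw [time, time, time, time, ← Finset.sum_Ico_eq_sub _ hk, ← Finset.sum_Ico_eq_sub _ hk]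
    exact Finset.sum_le_sum fun i _ => hαβ i
  rw [variation_of_constants X hmn hstep]
  have hbound := norm_sum_integral_le (X := X) (K := K₁) (q := q₁) (p := q₂) (r := r)
    (B := (‖X‖ * J + ‖B‖ * ‖W‖ * ρ) * δ + ‖B‖ * e) (C := ‖B‖ * K₂ * ρ) hK₁ hq₁ hX
    (by positivity) (by positivity) hr hα hmn
    (f := fun k τ => f k + (τ - time α k) • X (-(X (y k)) + f k + N k)) (by
      intro k hk τ hτ
      have ha := hα k
      have hmk := (Finset.mem_Ico.1 hk).1
      have hτ0 : 0 ≤ τ - time α k := sub_nonneg.2 hτ.1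
      have hτ1 : τ - time α k ≤ δ := by
        have := hτ.2
        rw [time_succ] at this
        linarith [hαδ k hk]
      have hs0 : 0 ≤ time β k - time β m := sub_nonneg.2 (time_mono hβ hmk)
      have h2 : ‖-(X (y k)) + f k + N k‖ ≤ J := by
        have h := hyJ k hk
        rw [hstep k hk, add_sub_cancel_left, norm_smul, Real.norm_of_nonneg ha.le] at h
        exact le_of_mul_le_mul_left h ha
      have h3 : ‖(τ - time α k) • X (-(X (y k)) + f k + N k)‖ ≤ δ * (‖X‖ * J) := by
        rw [norm_smul, Real.norm_of_nonneg hτ0]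
        exact mul_le_mul hτ1 ((X.le_opNorm _).trans (mul_le_mul_of_nonneg_left h2 (norm_nonneg _)))
          (norm_nonneg _) hδ
      set s := time β k - time β m with hs
      -- The fast transient is advanced by τ - t_k, so that its decay is in the integration variable
      -- τ itself; `h5` pays for the shift by an error of order δ.
      have h4 : ‖flow W (s + (τ - time α k)) (z m)‖ ≤
          K₂ * ρ * Real.exp (-(q₂ * (τ - time α m))) := by
        calc _ ≤ ‖flow W (s + (τ - time α k))‖ * ‖z m‖ := ContinuousLinearMap.le_opNorm _ _
          _ ≤ K₂ * Real.exp (-(q₂ * (s + (τ - time α k)))) * ρ :=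
            mul_le_mul (hW _ (by linarith)) hρ (norm_nonneg _) (by positivity)
          _ ≤ K₂ * Real.exp (-(q₂ * (τ - time α m))) * ρ := by
            gcongr
            linarith [htime k hmk]
          _ = _ := by ring
      have h5 : ‖flow W (s + (τ - time α k)) (z m) - flow W s (z m)‖ ≤ ‖W‖ * ρ * δ := by
        refine (norm_flow_sub_flow_le hWmono (z m) hs0 (by linarith)).trans ?_
        rw [add_sub_cancel_left]
        gcongr
      have h6 : ‖z k‖ ≤ e + ‖W‖ * ρ * δ + K₂ * ρ * Real.exp (-(q₂ * (τ - time α m))) := by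
        have h7 := norm_sub_norm_le (z k) (flow W s (z m))
        have h8 := norm_sub_norm_le (flow W s (z m)) (flow W (s + (τ - time α k)) (z m))
        rw [norm_sub_rev] at h8
        linarith [hze k hk]
      have h9 : ‖f k‖ ≤ ‖B‖ * (e + ‖W‖ * ρ * δ + K₂ * ρ * Real.exp (-(q₂ * (τ - time α m)))) := by
        rw [hf, norm_neg]
        exact (B.le_opNorm _).trans (mul_le_mul_of_nonneg_left h6 (norm_nonneg _))
      have h10 := norm_add_le (f k) ((τ - time α k) • X (-(X (y k)) + f k + N k))
      refine h10.trans ((add_le_add h9 h3).trans (le_of_eq ?_))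
      ring)
  rw [add_assoc, add_sub_cancel_left]
  refine (norm_add_le _ _).trans ?_
  linarith

end Deterministic

open scoped Matrix.Norms.L2Operator

/-! ### Matrices as operators; the recursions in centred coordinates -/

section Operators

variable {d : ℕ}

/-- A matrix as an operator on Euclidean space. -/
def op (A : Mat d) : Vec d →L[ℝ] Vec d := Matrix.toEuclideanCLM (n := Fin d) (𝕜 := ℝ) A

lemma op_apply (A : Mat d) (x : Vec d) : op A x = app A x := rfl

lemma norm_op (A : Mat d) : ‖op A‖ = ‖A‖ := Matrix.l2_opNorm_toEuclideanCLM A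

lemma op_mul_apply (A B : Mat d) (x : Vec d) : op (A * B) x = op A (op B x) := by
  simp [op, map_mul]

lemma op_sub (A B : Mat d) : op (A - B) = op A - op B := map_sub _ _ _

lemma op_one_apply (x : Vec d) : op (1 : Mat d) x = x := by simp [op]

/-- The passage from matrices to operators is an isometric algebra isomorphism, hence commutes with
the exponential. -/
lemma norm_flow_op (A : Mat d) (t : ℝ) : ‖flow (op A) t‖ = ‖NormedSpace.exp (-(t • A))‖ := by
  rw [← norm_op]
  congr 1
  have hcont : Continuous fun B : Mat d => op B := by
    have : LipschitzWith 1 fun B : Mat d => op B := LipschitzWith.of_dist_le_mul fun B C => by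
      rw [dist_eq_norm, dist_eq_norm, ← op_sub, norm_op]
      simp
    exact this.continuous
  let := NormedAlgebra.restrictScalars ℚ ℝ (Mat d)
  have h := NormedSpace.map_exp (Matrix.toEuclideanCLM (n := Fin d) (𝕜 := ℝ)) hcont (-(t • A))
  rw [flow, op, op, h, map_neg, map_smul]

lemma IsPosDef.inner_nonneg {A : Mat d} (hA : IsPosDef A) (x : Vec d) : 0 ≤ inner ℝ x (op A x) := by
  rw [op, Matrix.inner_toEuclideanCLM]
  by_cases hx : x.ofLp = 0
  · simp [hx]
  · exact (hA x.ofLp hx).le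

/-- A vector in the kernel would make the quadratic form vanish. -/
lemma IsPosDef.mul_inv {A : Mat d} (hA : IsPosDef A) : A * A⁻¹ = 1 := by
  refine Matrix.mul_nonsing_inv A ((Matrix.isUnit_iff_isUnit_det A).1
    (Matrix.mulVec_injective_iff_isUnit.1 ?_))
  refine (injective_iff_map_eq_zero A.mulVecLin).2 fun x hx => ?_
  by_contra hne
  have := hA x hne
  rw [show A.mulVec x = 0 from hx, dotProduct_zero] at this
  exact lt_irrefl _ this

lemma DecayBound.norm_flow_le {A : Mat d} {K q : ℝ} (h : DecayBound A K q) :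
    ∀ t, 0 ≤ t → ‖flow (op A) t‖ ≤ K * Real.exp (-(q * t)) := fun t ht => by
  rw [norm_flow_op]
  exact h.norm_exp_le t ht

end Operators

section Drift

variable {d : ℕ} (S : System d)

/-- The linear map through which a move of `θ` acts on `z`. -/
def System.coupling : Vec d →L[ℝ] Vec d := op (S.W₂⁻¹ * S.Γ₂)

lemma System.norm_coupling_le : ‖S.coupling‖ ≤ ‖S.W₂⁻¹‖ * ‖S.Γ₂‖ := by
  rw [System.coupling, norm_op]
  exact Matrix.l2_opNorm_mul _ _

lemma System.lam_eq (θ : Vec d) : S.lam θ = op S.W₂⁻¹ (S.v₂ - op S.Γ₂ θ) := rfl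

lemma System.lam_sub_lam (θ θ' : Vec d) : S.lam θ - S.lam θ' = -S.coupling (θ - θ') := by
  rw [S.lam_eq, S.lam_eq, ← map_sub, System.coupling, op_mul_apply, ← map_neg, map_sub (op S.Γ₂)]
  congr 1
  abel

lemma System.h₂_eq (hW₂ : IsPosDef S.W₂) (θ w : Vec d) :
    S.h₂ θ w = -(op S.W₂ (w - S.lam θ)) := by
  rw [map_sub, S.lam_eq, ← op_mul_apply, hW₂.mul_inv, op_one_apply, neg_sub]
  rfl

lemma System.h₁_eq (hX₁ : IsPosDef S.X₁) (θ w : Vec d) :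
    S.h₁ θ w = -(op S.X₁ (θ - S.θstar)) - op S.W₁ (w - S.lam θ) := by
  have h : op S.X₁ S.θstar = S.b₁ := by
    rw [System.θstar, ← op_apply, ← op_mul_apply, hX₁.mul_inv, op_one_apply]
  rw [map_sub, h, map_sub, S.lam_eq, map_sub, map_sub, System.X₁, op_sub,
    sub_apply, op_mul_apply, op_mul_apply, System.b₁, ← op_apply, op_mul_apply,
    System.h₁, ← op_apply, ← op_apply]
  abel

lemma System.norm_h₁_le (θ w : Vec d) :
    ‖S.h₁ θ w‖ ≤ ‖S.Γ₁‖ * ‖θ‖ + ‖S.W₁‖ * ‖w‖ + ‖S.v₁‖ := by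
  have h1 := norm_sub_le (S.v₁ - app S.Γ₁ θ) (app S.W₁ w)
  have h2 := norm_sub_le S.v₁ (app S.Γ₁ θ)
  have h3 : ‖app S.Γ₁ θ‖ ≤ ‖S.Γ₁‖ * ‖θ‖ := Matrix.l2_opNorm_mulVec _ _
  have h4 : ‖app S.W₁ w‖ ≤ ‖S.W₁‖ * ‖w‖ := Matrix.l2_opNorm_mulVec _ _
  rw [System.h₁]
  linarith

lemma System.norm_θstar_le : ‖S.θstar‖ ≤ S.Rstar := Matrix.l2_opNorm_mulVec _ _

lemma System.norm_lam_le (θ : Vec d) : ‖S.lam θ‖ ≤ ‖S.W₂⁻¹‖ * (‖S.v₂‖ + ‖S.Γ₂‖ * ‖θ‖) := by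
  have h1 : ‖S.lam θ‖ ≤ ‖S.W₂⁻¹‖ * ‖S.v₂ - app S.Γ₂ θ‖ := Matrix.l2_opNorm_mulVec _ _
  have h2 := norm_sub_le S.v₂ (app S.Γ₂ θ)
  have h3 : ‖app S.Γ₂ θ‖ ≤ ‖S.Γ₂‖ * ‖θ‖ := Matrix.l2_opNorm_mulVec _ _
  refine h1.trans (mul_le_mul_of_nonneg_left ?_ (norm_nonneg _))
  linarith

end Drift

/-! ### Positivity of the constants and meaning of the thresholds -/

lemma System.Rstar_nonneg {d : ℕ} (S : System d) : 0 ≤ S.Rstar :=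
  mul_nonneg (norm_nonneg _) (norm_nonneg _)

lemma Params.R₁out_eq {d : ℕ} (P : Params) (S : System d) :
    P.R₁out S = P.R₁in + 4 * P.La S := by
  rw [Params.R₁out, Params.La]
  ring

/-- The standing assumptions on the system and on the parameters. -/
structure Params.Admissible {d : ℕ} (P : Params) (S : System d) : Prop where
  W₂_pos : IsPosDef S.W₂
  X₁_pos : IsPosDef S.X₁
  decay₁ : DecayBound S.X₁ P.K₁ P.q₁
  decay₂ : DecayBound S.W₂ P.K₂ P.q₂
  q_mem : P.q ∈ Set.Ioo 0 P.qmin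
  R₁in_pos : 0 < P.R₁in
  R₂in_pos : 0 < P.R₂in
  R₂out_gt : P.R₂in < P.R₂out
  m₁_pos : 0 < P.m₁
  m₂_pos : 0 < P.m₂
  La_pos : 0 < P.La S

namespace Params.Admissible

variable {d : ℕ} {P : Params} {S : System d} (h : P.Admissible S)

include h

lemma K₁_pos : 0 < P.K₁ := zero_lt_one.trans_le h.decay₁.one_le

lemma K₂_pos : 0 < P.K₂ := zero_lt_one.trans_le h.decay₂.one_le

lemma q₁_pos : 0 < P.q₁ := h.decay₁.q_pos

lemma q₂_pos : 0 < P.q₂ := h.decay₂.q_pos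

lemma R₂out_pos : 0 < P.R₂out := h.R₂in_pos.trans h.R₂out_gt

/-- ‖W₁‖ is a factor of `La`, so `La_pos` excludes W₁ = 0, and with it d = 0. -/
lemma W₁_ne : S.W₁ ≠ 0 := by
  intro h0
  have := h.La_pos
  simp [Params.La, h0] at this

lemma norm_W₁_pos : 0 < ‖S.W₁‖ := norm_pos_iff.2 h.W₁_ne

lemma dim_pos : 0 < d := by
  rcases Nat.eq_zero_or_pos d with rfl | hd
  · exact absurd (Subsingleton.elim _ _) h.W₁_ne
  · exact hd

lemma R₁out_pos : 0 < P.R₁out S := by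
  rw [P.R₁out_eq S]
  linarith [h.R₁in_pos, h.La_pos]

lemma R₂w_pos : 0 < P.R₂w S := by
  have := h.R₂out_pos
  have := h.R₁out_pos
  have := S.Rstar_nonneg
  rw [Params.R₂w]
  positivity

lemma Rsum_pos : 0 < P.Rsum S := by
  have := h.R₂w_pos
  have := h.R₁out_pos
  have := S.Rstar_nonneg
  rw [Params.Rsum]
  positivity

lemma Jθ_nonneg : 0 ≤ P.Jθ S := by
  have := h.R₂w_pos
  have := h.Rsum_pos
  have := h.R₁out_pos
  have := S.Rstar_nonneg
  have := h.m₁_pos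
  rw [Params.Jθ]
  positivity

lemma Jz_nonneg : 0 ≤ P.Jz S := by
  have := h.Jθ_nonneg
  have := h.Rsum_pos
  have := h.R₂out_pos
  have := h.m₂_pos
  rw [Params.Jz]
  positivity

lemma Lc_pos : 0 < P.Lc S := by
  have := h.K₁_pos
  have := h.q₁_pos
  have := h.norm_W₁_pos
  rw [Params.Lc]
  positivity

lemma L₁md_pos : 0 < P.L₁md S := by
  have := h.K₁_pos
  have := h.m₁_pos
  have := h.Rsum_pos
  rw [Params.L₁md]
  positivity

lemma L₂md_pos : 0 < P.L₂md S := by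
  have := h.K₂_pos
  have := h.m₂_pos
  have := h.Rsum_pos
  rw [Params.L₂md]
  positivity

lemma Lz_pos : 0 < P.Lz S := by
  have := h.K₂_pos
  have := h.q₂_pos
  have := h.L₂md_pos
  have := h.Jθ_nonneg
  have := h.Jz_nonneg
  have := h.R₂in_pos
  rw [Params.Lz, Params.L₂de, Params.L₂sd]
  positivity

lemma Lb_pos : 0 < P.Lb S := by
  have := h.K₁_pos
  have := h.q₁_pos
  have := h.L₁md_pos
  have := h.Jθ_nonneg
  have := h.R₁in_pos
  have := h.R₂in_pos
  rw [Params.Lb, Params.L₁de, Params.Lb']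
  positivity

/-- `Lz` has room to spare: the terms ‖W₂‖ R₂in and `L₂md` are dropped. -/
lemma fast_error_le : P.K₂ / P.q₂ * (‖op S.W₂‖ * P.Jz S + ‖S.coupling‖ * P.Jθ S) ≤ P.Lz S := by
  have hK := h.K₂_pos
  have hq := h.q₂_pos
  have := h.L₂md_pos
  have hJ := h.Jθ_nonneg
  have := h.R₂in_pos
  have h1 : 0 ≤ ‖S.W₂‖ * P.R₂in := by positivity
  calc _ ≤ P.K₂ / P.q₂ * (‖S.W₂‖ * P.Jz S + ‖S.W₂⁻¹‖ * ‖S.Γ₂‖ * P.Jθ S) := by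
        rw [norm_op]
        gcongr
        exact S.norm_coupling_le
    _ = P.L₂de S + P.L₂sd S := by
        rw [Params.L₂de, Params.L₂sd]
        ring
    _ ≤ _ := by
        rw [Params.Lz]
        linarith

lemma slow_error_le :
    P.K₁ / P.q₁ * (‖op S.X₁‖ * P.Jθ S + ‖op S.W₁‖ * ‖op S.W₂‖ * P.R₂in) ≤ P.Lb S := by
  have := h.L₁md_pos
  have := h.R₁in_pos
  have h1 : 0 ≤ ‖S.X₁‖ * P.R₁in := by positivity
  calc _ = P.L₁de S + P.Lb' S := by
        rw [norm_op, norm_op, norm_op, Params.L₁de, Params.Lb']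
        ring
    _ ≤ _ := by
        rw [Params.Lb]
        linarith

end Params.Admissible

lemma exists_forall_ge_le_of_tendsto_zero {u : ℕ → ℝ} (hu : Tendsto u atTop (𝓝 0)) {c : ℝ}
    (hc : 0 < c) : ∃ N, ∀ k ≥ N, u k ≤ c :=
  eventually_atTop.1 (hu.eventually_le_const hc)

namespace StepsizeAssumption

variable {α β : ℕ → ℝ} (hs : StepsizeAssumption α β)

include hs

lemma α_le_β (n : ℕ) : α n ≤ β n := (div_le_one (hs.β_pos n)).1 (hs.η_le n)

/-- On ℕ the infimum of the empty set is 0, so a threshold has its defining property only once its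
set is known to be nonempty; vanishing stepsizes give this. -/
lemma Na_spec {d : ℕ} {P : Params} {S : System d} {ε₁ ε₂ : ℝ} (h : P.Admissible S)
    (hε₁ : 0 < ε₁) (hε₂ : 0 < ε₂) {k : ℕ} (hk : P.Na S ε₁ ε₂ α β ≤ k) :
    max (β k) (α k / β k) ≤ min (ε₁ / 8) (ε₂ / 3) / (P.Lz S * max (P.Lc S) 1) := by
  have hlim : Tendsto (fun k => max (β k) (α k / β k)) atTop (𝓝 0) := by
    simpa using hs.β_lim.max hs.η_lim
  have hmax : 0 < max (P.Lc S) 1 := lt_max_of_lt_right one_pos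
  have hmin : 0 < min (ε₁ / 8) (ε₂ / 3) := lt_min (by positivity) (by positivity)
  have hne := exists_forall_ge_le_of_tendsto_zero hlim
    (c := min (ε₁ / 8) (ε₂ / 3) / (P.Lz S * max (P.Lc S) 1)) (div_pos hmin (mul_pos h.Lz_pos hmax))
  exact Nat.sInf_mem (s := {N : ℕ | ∀ k ≥ N,
    max (β k) (α k / β k) ≤ min (ε₁ / 8) (ε₂ / 3) / (P.Lz S * max (P.Lc S) 1)}) hne k hk

lemma Nb_spec {d : ℕ} {P : Params} {S : System d} {ε₁ : ℝ} (h : P.Admissible S)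
    (hε₁ : 0 < ε₁) {k : ℕ} (hk : P.Nb S ε₁ β ≤ k) : β k ≤ ε₁ / (4 * P.Lb S) := by
  have hne := exists_forall_ge_le_of_tendsto_zero hs.β_lim (c := ε₁ / (4 * P.Lb S))
    (div_pos hε₁ (mul_pos four_pos h.Lb_pos))
  exact Nat.sInf_mem (s := {N : ℕ | ∀ k ≥ N, β k ≤ ε₁ / (4 * P.Lb S)}) hne k hk

end StepsizeAssumption

/-- Divergence of the stepsize sum makes the set nonempty, so its infimum is attained; monotonicity
of the clock extends the bound to all later n. -/
lemma exp_decay_le_of_sInf_le {γ : ℕ → ℝ} (hγ : ∀ n, 0 < γ n) (hsum : Tendsto (time γ) atTop atTop)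
    {C q c : ℝ} (hC : 0 ≤ C) (hq : 0 < q) (hc : 0 < c) {n₀ n : ℕ}
    (hn : sInf {j : ℕ | n₀ ≤ j ∧ C * Real.exp (-q * (time γ j - time γ n₀)) ≤ c} ≤ n) :
    n₀ ≤ n ∧ C * Real.exp (-(q * (time γ n - time γ n₀))) ≤ c := by
  set A := {j : ℕ | n₀ ≤ j ∧ C * Real.exp (-q * (time γ j - time γ n₀)) ≤ c} with hA
  have hlim : Tendsto (fun j => C * Real.exp (-q * (time γ j - time γ n₀))) atTop (𝓝 0) := by
    have h1 : Tendsto (fun j => -q * (time γ j - time γ n₀)) atTop atBot :=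
      (tendsto_atTop_add_const_right _ _ hsum).const_mul_atTop_of_neg (neg_lt_zero.2 hq)
    simpa using (Real.tendsto_exp_atBot.comp h1).const_mul C
  obtain ⟨N, hN⟩ := exists_forall_ge_le_of_tendsto_zero hlim hc
  have hmem : sInf A ∈ A := Nat.sInf_mem ⟨max n₀ N, le_max_left _ _, hN _ (le_max_right _ _)⟩
  refine ⟨hmem.1.trans hn, le_trans ?_ hmem.2⟩
  have := mul_le_mul_of_nonneg_left (time_mono hγ hn) hq.le
  gcongr
  linarith

/-! ### The pathwise argument in the outer balls -/

/-- The iterates are within the outer radii of their targets. -/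
def Params.InBall {d : ℕ} (P : Params) (S : System d) (θ w : Vec d) : Prop :=
  ‖θ - S.θstar‖ ≤ P.R₁out S ∧ ‖w - S.lam θ‖ ≤ P.R₂out

section InBall

variable {d : ℕ} {P : Params} {S : System d} {θ w : Vec d}

lemma Params.InBall.norm_θ_le (hb : P.InBall S θ w) : ‖θ‖ ≤ S.Rstar + P.R₁out S := by
  have h1 := norm_sub_norm_le θ S.θstar
  linarith [hb.1, S.norm_θstar_le]

lemma Params.InBall.norm_w_le (hb : P.InBall S θ w) : ‖w‖ ≤ P.R₂w S := by
  have h1 := norm_sub_norm_le w (S.lam θ)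
  have h2 : ‖S.lam θ‖ ≤ ‖S.W₂⁻¹‖ * (‖S.v₂‖ + ‖S.Γ₂‖ * (S.Rstar + P.R₁out S)) := by
    refine (S.norm_lam_le θ).trans ?_
    gcongr
    exact hb.norm_θ_le
  rw [Params.R₂w]
  linarith [hb.2]

lemma Params.InBall.one_add_norm_le (hb : P.InBall S θ w) : 1 + ‖θ‖ + ‖w‖ ≤ P.Rsum S := by
  rw [Params.Rsum]
  linarith [hb.norm_θ_le, hb.norm_w_le]

lemma Params.InBall.norm_slow_drift_le (hb : P.InBall S θ w) {M : Vec d}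
    (hM : ‖M‖ ≤ P.m₁ * P.Rsum S) : ‖S.h₁ θ w + M‖ ≤ P.Jθ S := by
  have h1 := norm_add_le (S.h₁ θ w) M
  have h2 := S.norm_h₁_le θ w
  have h3 := mul_le_mul_of_nonneg_left hb.norm_θ_le (norm_nonneg S.Γ₁)
  have h4 := mul_le_mul_of_nonneg_left hb.norm_w_le (norm_nonneg S.W₁)
  rw [Params.Jθ]
  linarith

end InBall

section Pathwise

variable {d : ℕ} {P : Params} {S : System d} {α β : ℕ → ℝ} {n₀ : ℕ} {θ w M₁ M₂ : ℕ → Vec d}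

lemma fast_recursion (hW₂ : IsPosDef S.W₂)
    {k : ℕ} (hw : w (k + 1) = w k + β k • (S.h₂ (θ k) (w k) + M₂ (k + 1))) :
    w (k + 1) - S.lam (θ (k + 1)) = w k - S.lam (θ k) +
      β k • (-(op S.W₂ (w k - S.lam (θ k))) + M₂ (k + 1)) +
        S.coupling ((θ (k + 1) - S.θstar) - (θ k - S.θstar)) := by
  have h1 := S.lam_sub_lam (θ (k + 1)) (θ k)
  rw [← S.h₂_eq hW₂, sub_sub_sub_cancel_right, hw, ← neg_eq_iff_eq_neg.2 h1]
  abel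

lemma slow_recursion (hX₁ : IsPosDef S.X₁)
    {k : ℕ} (hθ : θ (k + 1) = θ k + α k • (S.h₁ (θ k) (w k) + M₁ (k + 1))) :
    θ (k + 1) - S.θstar = θ k - S.θstar +
      α k • (-(op S.X₁ (θ k - S.θstar)) - op S.W₁ (w k - S.lam (θ k)) + M₁ (k + 1)) := by
  rw [← S.h₁_eq hX₁, hθ]
  abel

lemma norm_slow_step_le (hs : StepsizeAssumption α β) {k : ℕ}
    (hθ : θ (k + 1) = θ k + α k • (S.h₁ (θ k) (w k) + M₁ (k + 1)))
    (hM₁ : ‖M₁ (k + 1)‖ ≤ P.m₁ * P.Rsum S) (hb : P.InBall S (θ k) (w k)) :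
    ‖θ (k + 1) - S.θstar - (θ k - S.θstar)‖ ≤ α k * P.Jθ S := by
  rw [sub_sub_sub_cancel_right, hθ, add_sub_cancel_left, norm_smul,
    Real.norm_of_nonneg (hs.α_pos k).le]
  exact mul_le_mul_of_nonneg_left (hb.norm_slow_drift_le hM₁) (hs.α_pos k).le

lemma norm_fast_step_le (h : P.Admissible S) (hs : StepsizeAssumption α β) {k : ℕ}
    (hθ : θ (k + 1) = θ k + α k • (S.h₁ (θ k) (w k) + M₁ (k + 1)))
    (hw : w (k + 1) = w k + β k • (S.h₂ (θ k) (w k) + M₂ (k + 1)))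
    (hM₁ : ‖M₁ (k + 1)‖ ≤ P.m₁ * P.Rsum S) (hM₂ : ‖M₂ (k + 1)‖ ≤ P.m₂ * P.Rsum S)
    (hb : P.InBall S (θ k) (w k)) :
    ‖w (k + 1) - S.lam (θ (k + 1)) - (w k - S.lam (θ k))‖ ≤ β k * P.Jz S := by
  have hstep := norm_slow_step_le hs hθ hM₁ hb
  rw [fast_recursion h.W₂_pos hw, add_assoc, add_sub_cancel_left]
  set Δ := θ (k + 1) - S.θstar - (θ k - S.θstar)
  have h1 : ‖-(op S.W₂ (w k - S.lam (θ k))) + M₂ (k + 1)‖ ≤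
      ‖S.W₂‖ * P.R₂out + P.m₂ * P.Rsum S := by
    refine (norm_add_le _ _).trans (add_le_add ?_ hM₂)
    rw [norm_neg, ← norm_op]
    exact ((op S.W₂).le_opNorm _).trans (mul_le_mul_of_nonneg_left hb.2 (norm_nonneg _))
  have h2 : ‖S.coupling Δ‖ ≤ β k * (‖S.W₂⁻¹‖ * ‖S.Γ₂‖ * P.Jθ S) := by
    have hJ := h.Jθ_nonneg
    have hβ := hs.β_pos k
    calc ‖S.coupling Δ‖ ≤ ‖S.coupling‖ * ‖Δ‖ := S.coupling.le_opNorm _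
      _ ≤ (‖S.W₂⁻¹‖ * ‖S.Γ₂‖) * (β k * P.Jθ S) := by
        refine mul_le_mul S.norm_coupling_le (hstep.trans ?_) (norm_nonneg _) (by positivity)
        exact mul_le_mul_of_nonneg_right (hs.α_le_β k) hJ
      _ = _ := by ring
  refine (norm_add_le _ _).trans ?_
  rw [norm_smul, Real.norm_of_nonneg (hs.β_pos k).le, Params.Jz]
  have h3 := mul_le_mul_of_nonneg_left h1 (hs.β_pos k).le
  linarith

/-- If the noise sums are small as long as the iterates stay in the outer balls, then the iterates
never leave these balls, and they are eventually as close to their targets as claimed. -/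
theorem inBall_and_close (h : P.Admissible S) (hs : StepsizeAssumption α β) {ε₁ ε₂ : ℝ}
    (hε₁ : 0 < ε₁) (hε₁La : ε₁ < 4 * P.La S) (hε₂ : 0 < ε₂) (hε₂R : ε₂ < P.R₂out - P.R₂in)
    {n₁ : ℕ} (hn₀ : P.N₀ S ε₁ ε₂ α β ≤ n₀) (hn₁ : P.N₁ S n₀ ε₁ ε₂ α β ≤ n₁)
    (hθ : ∀ k ≥ n₀, θ (k + 1) = θ k + α k • (S.h₁ (θ k) (w k) + M₁ (k + 1)))
    (hw : ∀ k ≥ n₀, w (k + 1) = w k + β k • (S.h₂ (θ k) (w k) + M₂ (k + 1)))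
    (hM₁ : ∀ k ≥ n₀, ‖M₁ (k + 1)‖ ≤ P.m₁ * (1 + ‖θ k‖ + ‖w k‖))
    (hM₂ : ∀ k ≥ n₀, ‖M₂ (k + 1)‖ ≤ P.m₂ * (1 + ‖θ k‖ + ‖w k‖))
    (hθ₀ : ‖θ n₀ - S.θstar‖ ≤ P.R₁in) (hz₀ : ‖w n₀ - S.lam (θ n₀)‖ ≤ P.R₂in)
    (hnoise : ∀ n ≥ n₀, (∀ k ∈ Finset.Ico n₀ n, P.InBall S (θ k) (w k)) →
      ‖noiseSum (op S.X₁) α n₀ n fun k => M₁ (k + 1)‖ ≤ ε₁ / 4 ∧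
      ‖noiseSum (op S.W₂) β n₀ n fun k => M₂ (k + 1)‖ ≤ ε₂ / 3 ∧
      ‖noiseSum (op S.W₂) β n₀ n fun k => M₂ (k + 1)‖ ≤ ε₁ / (8 * P.Lc S)) :
    ∀ n ≥ n₀, P.InBall S (θ n) (w n) ∧
      (n₁ ≤ n → ‖θ n - S.θstar‖ ≤ ε₁ ∧ ‖w n - S.lam (θ n)‖ ≤ ε₂) := by
  intro n hn
  induction n using Nat.strong_induction_on with
  | _ n ih =>
  have hball : ∀ k ∈ Finset.Ico n₀ n, P.InBall S (θ k) (w k) := fun k hk =>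
    (ih k (Finset.mem_Ico.1 hk).2 (Finset.mem_Ico.1 hk).1).1
  have hMb₁ : ∀ k ∈ Finset.Ico n₀ n, ‖M₁ (k + 1)‖ ≤ P.m₁ * P.Rsum S := fun k hk =>
    (hM₁ k (Finset.mem_Ico.1 hk).1).trans
      (mul_le_mul_of_nonneg_left (hball k hk).one_add_norm_le h.m₁_pos.le)
  have hMb₂ : ∀ k ∈ Finset.Ico n₀ n, ‖M₂ (k + 1)‖ ≤ P.m₂ * P.Rsum S := fun k hk =>
    (hM₂ k (Finset.mem_Ico.1 hk).1).trans
      (mul_le_mul_of_nonneg_left (hball k hk).one_add_norm_le h.m₂_pos.le)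
  have hmax : 0 < max (P.Lc S) 1 := lt_max_of_lt_right one_pos
  have hLc := h.Lc_pos
  have hLz := h.Lz_pos
  have hLb := h.Lb_pos
  have hmin : 0 < min (ε₁ / 8) (ε₂ / 3) := lt_min (by positivity) (by positivity)
  -- The error budget of the fast iterate apart from noise: at most ε₂ / 3 directly, and at most ε₁
  -- / 8 after transmission to θ with gain `Lc`.
  set e₀ := min (ε₁ / 8) (ε₂ / 3) / max (P.Lc S) 1 with he₀
  have he₀pos : 0 < e₀ := div_pos hmin hmax
  have he₀ε₂ : e₀ ≤ ε₂ / 3 := (div_le_self hmin.le (le_max_right _ _)).trans (min_le_right _ _)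
  have he₀Lc : P.Lc S * e₀ ≤ ε₁ / 8 := by
    rw [he₀, mul_div_assoc', div_le_iff₀ hmax, mul_comm]
    exact mul_le_mul (min_le_left _ _) (le_max_left _ _) hLc.le (by positivity)
  -- All j ≤ n are needed, because θ at time n depends on the whole past of z.
  have hfast : ∀ j, n₀ ≤ j → j ≤ n →
      ‖(w j - S.lam (θ j)) - flow (op S.W₂) (time β j - time β n₀) (w n₀ - S.lam (θ n₀))‖ ≤
        e₀ + ‖noiseSum (op S.W₂) β n₀ j fun k => M₂ (k + 1)‖ := by
    intro j hj hjn
    have hsub : ∀ k ∈ Finset.Ico n₀ j, k ∈ Finset.Ico n₀ n := fun k hk =>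
      Finset.Ico_subset_Ico_right hjn hk
    have hstepsize : ∀ k ∈ Finset.Ico n₀ j, max (β k) (α k / β k) ≤ e₀ / P.Lz S := by
      intro k hk
      refine (hs.Na_spec h hε₁ hε₂ ((le_max_left _ _).trans
        (hn₀.trans (Finset.mem_Ico.1 hk).1))).trans_eq ?_
      rw [he₀, div_div, mul_comm]
    have hf := norm_fast_sub_flow_le (W := op S.W₂) (D := S.coupling) h.K₂_pos.le h.q₂_pos
      h.decay₂.norm_flow_le hs.β_pos hj (α := α) (y := fun k => θ k - S.θstar)
      (z := fun k => w k - S.lam (θ k)) (N := fun k => M₂ (k + 1)) (δ := e₀ / P.Lz S)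
      h.Jθ_nonneg h.Jz_nonneg (by positivity)
      (fun k hk => fast_recursion h.W₂_pos (hw k (Finset.mem_Ico.1 hk).1))
      (fun k hk => norm_slow_step_le hs (hθ k (Finset.mem_Ico.1 hk).1) (hMb₁ k (hsub k hk))
        (hball k (hsub k hk)))
      (fun k hk => norm_fast_step_le h hs (hθ k (Finset.mem_Ico.1 hk).1)
        (hw k (Finset.mem_Ico.1 hk).1) (hMb₁ k (hsub k hk)) (hMb₂ k (hsub k hk))
        (hball k (hsub k hk)))
      (fun k hk => (le_max_left _ _).trans (hstepsize k hk))
      (fun k hk => (le_max_right _ _).trans (hstepsize k hk))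
    have herr := mul_le_mul_of_nonneg_right h.fast_error_le
      (show 0 ≤ e₀ / P.Lz S by positivity)
    rw [mul_div_cancel₀ _ hLz.ne', mul_assoc] at herr
    linarith
  have hslow := norm_slow_sub_flow_le (X := op S.X₁) (W := op S.W₂) (B := op S.W₁) (r := P.q)
    h.K₁_pos.le h.q₁_pos h.decay₁.norm_flow_le h.K₂_pos.le h.q₂_pos h.decay₂.norm_flow_le
    h.W₂_pos.inner_nonneg h.q_mem.2 hs.α_pos hs.α_le_β hn (y := fun k => θ k - S.θstar)
    (z := fun k => w k - S.lam (θ k)) (N := fun k => M₁ (k + 1))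
    (δ := ε₁ / (4 * P.Lb S)) (e := e₀ + ε₁ / (8 * P.Lc S)) h.Jθ_nonneg (by positivity)
    (by positivity)
    (fun k hk => slow_recursion h.X₁_pos (hθ k (Finset.mem_Ico.1 hk).1))
    (fun k hk => norm_slow_step_le hs (hθ k (Finset.mem_Ico.1 hk).1) (hMb₁ k hk) (hball k hk))
    (fun k hk => by
      have hk' := Finset.mem_Ico.1 hk
      refine (hfast k hk'.1 hk'.2.le).trans ?_
      gcongr
      exact (hnoise k hk'.1 fun i hi => hball i (Finset.Ico_subset_Ico_right hk'.2.le hi)).2.2)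
    hz₀
    (fun k hk => (hs.α_le_β k).trans (hs.Nb_spec h hε₁ ((le_max_right _ _).trans
      (hn₀.trans (Finset.mem_Ico.1 hk).1))))
  obtain ⟨hnoise₁, hnoise₂, -⟩ := hnoise n hn hball
  have hfastn := hfast n hn le_rfl
  -- The budget is ε₁/4 for discretisation, and ε₁/8 each for the error and the noise inherited from
  -- z.
  have herr₁ : P.K₁ / P.q₁ * ((‖op S.X₁‖ * P.Jθ S + ‖op S.W₁‖ * ‖op S.W₂‖ * P.R₂in) *
      (ε₁ / (4 * P.Lb S)) + ‖op S.W₁‖ * (e₀ + ε₁ / (8 * P.Lc S))) ≤ ε₁ / 2 := by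
    have h1 := mul_le_mul_of_nonneg_right h.slow_error_le
      (show 0 ≤ ε₁ / (4 * P.Lb S) by positivity)
    have h2 : P.Lb S * (ε₁ / (4 * P.Lb S)) = ε₁ / 4 := by field_simp
    have h3 : P.K₁ / P.q₁ * ‖op S.W₁‖ = P.Lc S := by
      rw [norm_op, Params.Lc]
      ring
    have h4 : P.Lc S * (ε₁ / (8 * P.Lc S)) = ε₁ / 8 := by field_simp
    calc _ = P.K₁ / P.q₁ * (‖op S.X₁‖ * P.Jθ S + ‖op S.W₁‖ * ‖op S.W₂‖ * P.R₂in) *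
          (ε₁ / (4 * P.Lb S)) + P.K₁ / P.q₁ * ‖op S.W₁‖ * (e₀ + ε₁ / (8 * P.Lc S)) := by ring
      _ ≤ ε₁ / 2 := by
        rw [h3, mul_add (P.Lc S), h4]
        linarith
  have hLa : P.K₁ * (‖op S.W₁‖ * P.K₂ * P.R₂in) *
      (1 / ((min P.q₁ P.q₂ - P.q) * Real.exp 1)) = P.La S := by
    rw [norm_op, Params.La, Params.qmin]
    ring
  rw [hLa] at hslow
  set Δt := time α n - time α n₀ with hΔt
  set Δs := time β n - time β n₀ with hΔs
  have hΔt0 : 0 ≤ Δt := sub_nonneg.2 (time_mono hs.α_pos hn)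
  have hΔs0 : 0 ≤ Δs := sub_nonneg.2 (time_mono hs.β_pos hn)
  have hy := norm_sub_norm_le (θ n - S.θstar) (flow (op S.X₁) Δt (θ n₀ - S.θstar))
  have hz := norm_sub_norm_le (w n - S.lam (θ n)) (flow (op S.W₂) Δs (w n₀ - S.lam (θ n₀)))
  refine ⟨⟨?_, ?_⟩, fun hn₁n => ?_⟩
  -- R₁in + La + ε₁/2 + ε₁/4 is below R₁in + 4 La because ε₁ < 4 La. The contraction bound is
  -- essential: the decay bound would give K₁ R₁in.
  · have hflow := norm_flow_apply_le h.X₁_pos.inner_nonneg (θ n₀ - S.θstar) hΔt0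
    have hexp : P.La S * Real.exp (-(P.q * Δt)) ≤ P.La S :=
      mul_le_of_le_one_right h.La_pos.le
        (Real.exp_le_one_iff.2 (neg_nonpos.2 (mul_nonneg h.q_mem.1.le hΔt0)))
    rw [P.R₁out_eq]
    linarith
  · have hflow := norm_flow_apply_le h.W₂_pos.inner_nonneg (w n₀ - S.lam (θ n₀)) hΔs0
    linarith
  · have hKR₁ : 0 < P.K₁ * P.R₁in := mul_pos h.K₁_pos h.R₁in_pos
    have hdec₁ := (exp_decay_le_of_sInf_le hs.α_pos hs.α_sum (C := P.K₁ * P.R₁in + P.La S)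
      (c := ε₁ / 4) (by linarith [h.La_pos]) h.q_mem.1 (by positivity)
      ((le_max_left _ _).trans (hn₁.trans hn₁n))).2
    have hdec₂ := (exp_decay_le_of_sInf_le hs.β_pos hs.β_sum (C := P.K₂ * P.R₂in) (c := ε₂ / 3)
      (mul_pos h.K₂_pos h.R₂in_pos).le h.q₂_pos (by positivity)
      ((le_max_right _ _).trans (hn₁.trans hn₁n))).2
    have hflow₁ : ‖flow (op S.X₁) Δt (θ n₀ - S.θstar)‖ ≤
        P.K₁ * P.R₁in * Real.exp (-(P.q * Δt)) := by
      -- The rate is lowered to q so that both transients of θ decay alike; together they take the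
      -- last ε₁/4.
      have hq : P.q ≤ P.q₁ := h.q_mem.2.le.trans (min_le_left _ _)
      have hK := h.K₁_pos
      calc _ ≤ ‖flow (op S.X₁) Δt‖ * ‖θ n₀ - S.θstar‖ := ContinuousLinearMap.le_opNorm _ _
        _ ≤ P.K₁ * Real.exp (-(P.q₁ * Δt)) * P.R₁in :=
          mul_le_mul (h.decay₁.norm_flow_le _ hΔt0) hθ₀ (norm_nonneg _) (by positivity)
        _ = P.K₁ * P.R₁in * Real.exp (-(P.q₁ * Δt)) := by ring
        _ ≤ _ := by gcongr
    have hflow₂ : ‖flow (op S.W₂) Δs (w n₀ - S.lam (θ n₀))‖ ≤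
        P.K₂ * P.R₂in * Real.exp (-(P.q₂ * Δs)) := by
      have hK := h.K₂_pos
      calc _ ≤ ‖flow (op S.W₂) Δs‖ * ‖w n₀ - S.lam (θ n₀)‖ := ContinuousLinearMap.le_opNorm _ _
        _ ≤ P.K₂ * Real.exp (-(P.q₂ * Δs)) * P.R₂in :=
          mul_le_mul (h.decay₂.norm_flow_le _ hΔs0) hz₀ (norm_nonneg _) (by positivity)
        _ = _ := by ring
    constructor
    · linarith
    · linarith

end Pathwise

/-! ### Tail bounds for the noise sums -/

section Constants

lemma two_mul_le_dimFactor {d : ℕ} (hd : 0 < d) : 2 * (d : ℝ) ≤ Params.dimFactor d := by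
  rcases Nat.lt_or_ge 1 d with h | h
  · have h2 : (2 : ℝ) ≤ d := by exact_mod_cast h
    refine le_max_of_le_left ?_
    nlinarith [mul_nonneg (mul_nonneg (by linarith : (0 : ℝ) ≤ d) (sub_nonneg.2 h2))
      (by linarith : (0 : ℝ) ≤ d + 2)]
  · obtain rfl : d = 1 := by omega
    simp [Params.dimFactor]

/-- Here s is 16, 9 or 64 Lc², the inverse square of the share of ε given to the noise. The factor
K² is slack, since L already contains K, and so is the excess of `dimFactor` over the 2d of Azuma's
inequality. -/
lemma inv_mul_sq_le {d : ℕ} (hd : 0 < d) {s K L ε t : ℝ} (hs : 0 < s) (hK : 1 ≤ K) (hL : 0 < L)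
    (ht : t ^ 2 = ε ^ 2 / s) :
    (s * K ^ 2 * Params.dimFactor d * L ^ 2)⁻¹ * ε ^ 2 ≤ t ^ 2 / (2 * d * L ^ 2) := by
  have hd' : (0 : ℝ) < d := by exact_mod_cast hd
  have hD := two_mul_le_dimFactor hd
  have h1 : 2 * (d : ℝ) ≤ K ^ 2 * Params.dimFactor d := by
    nlinarith [mul_nonneg (sub_nonneg.2 (one_le_pow₀ hK : 1 ≤ K ^ 2)) (by linarith :
      0 ≤ Params.dimFactor d)]
  rw [ht, div_div, inv_mul_eq_div]
  refine div_le_div_of_nonneg_left (sq_nonneg ε) (by positivity) ?_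
  calc s * (2 * d * L ^ 2) = s * (2 * d) * L ^ 2 := by ring
    _ ≤ s * (K ^ 2 * Params.dimFactor d) * L ^ 2 := by gcongr
    _ = _ := by ring

end Constants

section NoiseTail

variable {Ω : Type*} [mΩ : MeasurableSpace Ω] {μ : Measure Ω} [IsProbabilityMeasure μ]

lemma azumaSum_pos {γ : ℕ → ℝ} (hγ : ∀ n, 0 < γ n) (p : ℝ) {n : ℕ} (hn : 0 < n) :
    0 < azumaSum γ p n :=
  Finset.sum_pos (fun k _ => mul_pos (pow_pos (hγ k) 2) (Real.exp_pos _))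
    ⟨0, Finset.mem_range.2 hn⟩

/-- Tail bound for the accumulated effect of bounded martingale-difference noise. -/
lemma measure_noiseSum_gt_le {d : ℕ} (hd : 0 < d) {F : ℕ → MeasurableSpace Ω}
    (hF : ∀ n, F n ≤ mΩ) (hmono : Monotone F) {N : ℕ → Ω → Vec d} {m n : ℕ} (hmn : m ≤ n)
    (hN : ∀ k ≥ m, StronglyMeasurable[F (k + 1)] (N k)) {R : ℝ} (hR : 0 < R)
    (hb : ∀ k ≥ m, ∀ᵐ ω ∂μ, ‖N k ω‖ ≤ R)
    (hce : ∀ k ≥ m, μ[N k | F k] =ᵐ[μ] 0) {A : Mat d} {K q : ℝ} (hA : DecayBound A K q)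
    {γ : ℕ → ℝ} (hγ : ∀ n, 0 < γ n) {t x : ℝ} (ht : 0 ≤ t)
    (hx : x ≤ t ^ 2 / (2 * d * (K * R) ^ 2)) :
    μ {ω | t < ‖noiseSum (op A) γ m n fun k => N k ω‖} ≤
      2 * (d : ENNReal) ^ 2 * expTerm x (azumaSum γ q n) := by
  -- For n = m the sum is empty and the strict inequality fails everywhere; this covers n = 0, where
  -- `azumaSum` vanishes.
  rcases hmn.eq_or_lt with rfl | hlt
  · simp [noiseSum, ht.not_gt]
  have ha := azumaSum_pos hγ q ((Nat.zero_le m).trans_lt hlt)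
  have hK : 0 < K := zero_lt_one.trans_le hA.one_le
  have hd' : (0 : ℝ) < d := by exact_mod_cast hd
  have hdE : (d : ENNReal) ≤ (d : ENNReal) ^ 2 := by
    exact_mod_cast Nat.le_self_pow two_ne_zero d
  have htail := measure_norm_sum_gt_le (μ := μ) hF hmono hlt hN hb hce
    (A := fun k => kernel (op A) (time γ n) (time γ k) (time γ (k + 1)))
    (c := fun k => K * R * (γ k * Real.exp (-(q * (time γ n - time γ (k + 1))))))
    (fun k => by have := hγ k; positivity)
    (fun k hk => by
      have h := norm_kernel_le hK.le hA.q_pos.le hA.norm_flow_le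
        (time_mono hγ (Nat.le_succ k)) (time_mono hγ (Finset.mem_Ico.1 hk).2)
      refine (mul_le_mul_of_nonneg_right h hR.le).trans_eq ?_
      rw [Nat.succ_eq_add_one, show time γ (k + 1) - time γ k = γ k by rw [time_succ]; ring]
      ring)
    ht (V := (K * R) ^ 2 * azumaSum γ q n) (by
      -- `azumaSum` starts at 0 rather than m; the extra terms are nonnegative.
      rw [azumaSum, Finset.mul_sum]
      refine (Finset.sum_le_sum_of_subset_of_nonneg (t := Finset.range n) (fun k hk =>
        Finset.mem_range.2 (Finset.mem_Ico.1 hk).2) fun _ _ _ => sq_nonneg _).trans_eq ?_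
      refine Finset.sum_congr rfl fun k hk => ?_
      rw [Finset.sum_Ico_eq_sub γ (Finset.mem_range.1 hk), mul_pow, mul_pow, mul_pow, ← Real.exp_nat_mul]
      rw [time, time, Nat.succ_eq_add_one]
      push_cast
      ring_nf)
  refine htail.trans ?_
  rw [expTerm, if_neg ha.ne']
  refine mul_le_mul' (by gcongr) (ENNReal.ofReal_le_ofReal (Real.exp_le_exp.2 ?_))
  rw [neg_div, neg_div, neg_le_neg_iff]
  calc x / azumaSum γ q n ≤ t ^ 2 / (2 * d * (K * R) ^ 2) / azumaSum γ q n := by gcongr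
    _ = _ := by rw [div_div]; ring_nf

end NoiseTail

/-! ### Adaptedness and the stopped noise -/

section History

variable {Ω : Type*} {d : ℕ} {S : System d} {α β : ℕ → ℝ} {n₀ : ℕ} {θ w M₁ M₂ : ℕ → Ω → Vec d}

lemma history_mono : Monotone (history n₀ θ w M₁ M₂) := fun _ _ hmn =>
  sup_le_sup_left (biSup_mono fun _ hk => ⟨hk.1, hk.2.trans hmn⟩) _

lemma measurable_history_θ₀ (n : ℕ) : Measurable[history n₀ θ w M₁ M₂ n] (θ n₀) :=
  (comap_measurable (θ n₀)).mono (le_sup_left.trans le_sup_left) le_rfl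

lemma measurable_history_w₀ (n : ℕ) : Measurable[history n₀ θ w M₁ M₂ n] (w n₀) :=
  (comap_measurable (w n₀)).mono (le_sup_right.trans le_sup_left) le_rfl

lemma measurable_history_M₁ {k n : ℕ} (hk : k ∈ Set.Ioc n₀ n) :
    Measurable[history n₀ θ w M₁ M₂ n] (M₁ k) :=
  (comap_measurable (M₁ k)).mono ((le_sup_left.trans (le_biSup (fun k =>
    MeasurableSpace.comap (M₁ k) inferInstance ⊔ MeasurableSpace.comap (M₂ k) inferInstance)
      hk)).trans le_sup_right) le_rfl

lemma measurable_history_M₂ {k n : ℕ} (hk : k ∈ Set.Ioc n₀ n) :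
    Measurable[history n₀ θ w M₁ M₂ n] (M₂ k) :=
  (comap_measurable (M₂ k)).mono ((le_sup_right.trans (le_biSup (fun k =>
    MeasurableSpace.comap (M₁ k) inferInstance ⊔ MeasurableSpace.comap (M₂ k) inferInstance)
      hk)).trans le_sup_right) le_rfl

lemma System.measurable_h₁ (S : System d) {mΩ : MeasurableSpace Ω} {f g : Ω → Vec d}
    (hf : Measurable f) (hg : Measurable g) : Measurable fun ω => S.h₁ (f ω) (g ω) :=
  (measurable_const.sub ((op S.Γ₁).measurable.comp hf)).sub ((op S.W₁).measurable.comp hg)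

lemma System.measurable_h₂ (S : System d) {mΩ : MeasurableSpace Ω} {f g : Ω → Vec d}
    (hf : Measurable f) (hg : Measurable g) : Measurable fun ω => S.h₂ (f ω) (g ω) :=
  (measurable_const.sub ((op S.Γ₂).measurable.comp hf)).sub ((op S.W₂).measurable.comp hg)

lemma System.measurable_lam (S : System d) {mΩ : MeasurableSpace Ω} {f : Ω → Vec d}
    (hf : Measurable f) : Measurable fun ω => S.lam (f ω) :=
  (op S.W₂⁻¹).measurable.comp (measurable_const.sub ((op S.Γ₂).measurable.comp hf))

/-- The iterates are adapted to the history. -/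
lemma measurable_history_iterates (hSA : IsTwoTimescaleSA S α β n₀ θ w M₁ M₂) {n : ℕ}
    (hn : n₀ ≤ n) :
    Measurable[history n₀ θ w M₁ M₂ n] (θ n) ∧ Measurable[history n₀ θ w M₁ M₂ n] (w n) := by
  induction n, hn using Nat.le_induction with
  | base => exact ⟨measurable_history_θ₀ n₀, measurable_history_w₀ n₀⟩
  | succ n hn ih =>
    have hle : history n₀ θ w M₁ M₂ n ≤ history n₀ θ w M₁ M₂ (n + 1) :=
      history_mono (Nat.le_succ n)
    have hθ := ih.1.mono hle le_rfl
    have hw := ih.2.mono hle le_rfl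
    have hmem : n + 1 ∈ Set.Ioc n₀ (n + 1) := ⟨Nat.lt_succ_of_le hn, le_rfl⟩
    rw [funext fun ω => (hSA n hn ω).1, funext fun ω => (hSA n hn ω).2]
    exact ⟨hθ.add (((S.measurable_h₁ hθ hw).add (measurable_history_M₁ hmem)).const_smul (α n)),
      hw.add (((S.measurable_h₂ hθ hw).add (measurable_history_M₂ hmem)).const_smul (β n))⟩

/-- The event that the iterates stay in the outer balls from time `n₀` up to time `k`. -/
def stayEvent (P : Params) (S : System d) (n₀ : ℕ) (θ w : ℕ → Ω → Vec d) (k : ℕ) : Set Ω :=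
  {ω | ∀ j ∈ Finset.Icc n₀ k, P.InBall S (θ j ω) (w j ω)}

lemma measurableSet_stayEvent (P : Params) (hSA : IsTwoTimescaleSA S α β n₀ θ w M₁ M₂) (k : ℕ) :
    MeasurableSet[history n₀ θ w M₁ M₂ k] (stayEvent P S n₀ θ w k) := by
  rw [stayEvent, Set.ofPred_forall]
  refine MeasurableSet.iInter fun j => ?_
  rw [Set.ofPred_forall]
  refine MeasurableSet.iInter fun hj => ?_
  have hj' := Finset.mem_Icc.1 hj
  have hm := measurable_history_iterates hSA hj'.1
  have hle : history n₀ θ w M₁ M₂ j ≤ history n₀ θ w M₁ M₂ k := history_mono hj'.2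
  have hθ := hm.1.mono hle le_rfl
  have hw := hm.2.mono hle le_rfl
  let := history n₀ θ w M₁ M₂ k
  exact (measurableSet_le (hθ.sub measurable_const).norm measurable_const).inter
    (measurableSet_le (hw.sub (S.measurable_lam hθ)).norm measurable_const)

variable [mΩ : MeasurableSpace Ω] {μ : Measure Ω} {m₁ m₂ : ℝ}

lemma NoiseAssumption.history_le (hnoise : NoiseAssumption μ n₀ θ w M₁ M₂ m₁ m₂) (n : ℕ) :
    history n₀ θ w M₁ M₂ n ≤ mΩ := by
  refine sup_le (sup_le hnoise.θ_meas.comap_le hnoise.w_meas.comap_le)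
    (iSup₂_le fun k hk => ?_)
  obtain ⟨j, rfl⟩ : ∃ j, k = j + 1 := Nat.exists_eq_succ_of_ne_zero (Nat.ne_zero_of_lt hk.1)
  have hj : n₀ ≤ j := Nat.lt_succ_iff.1 hk.1
  exact sup_le (hnoise.M₁_meas j hj).comap_le (hnoise.M₂_meas j hj).comap_le

lemma condExp_indicator_eq_zero {m : MeasurableSpace Ω} {M : Ω → Vec d} {G : Set Ω}
    (hM : Integrable M μ) (hG : MeasurableSet[m] G) (h0 : μ[M | m] =ᵐ[μ] 0) :
    μ[G.indicator M | m] =ᵐ[μ] 0 := by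
  filter_upwards [condExp_indicator hM hG, h0] with ω h1 h2
  rw [h1]
  exact Set.indicator_apply_eq_zero.2 fun _ => h2

end History

/-- The sum up to n only involves staying up to n - 1, exactly what is known in the induction before
the iterates at n are controlled. -/
lemma noiseSum_indicator_eq {Ω : Type*} {d : ℕ} {P : Params} {S : System d} {n₀ n : ℕ}
    {θ w M : ℕ → Ω → Vec d} {ω : Ω} (X : Vec d →L[ℝ] Vec d) (γ : ℕ → ℝ)
    (hstay : ∀ k ∈ Finset.Ico n₀ n, P.InBall S (θ k ω) (w k ω)) :
    (noiseSum X γ n₀ n fun k => (stayEvent P S n₀ θ w k).indicator (M (k + 1)) ω) =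
      noiseSum X γ n₀ n fun k => M (k + 1) ω := by
  refine Finset.sum_congr rfl fun k hk => ?_
  refine congrArg _ (Set.indicator_of_mem (fun j hj => ?_) _)
  exact hstay j (Finset.mem_Ico.2 ⟨(Finset.mem_Icc.1 hj).1,
    (Finset.mem_Icc.1 hj).2.trans_lt (Finset.mem_Ico.1 hk).2⟩)

section StoppedNoise

variable {Ω : Type*} [mΩ : MeasurableSpace Ω] {μ : Measure Ω} [IsProbabilityMeasure μ]
  {d : ℕ} {P : Params} {S : System d} {α β : ℕ → ℝ} {n₀ : ℕ} {θ w M₁ M₂ M : ℕ → Ω → Vec d}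

/-- Tail bound for the noise stopped when the iterates leave the outer balls. -/
lemma measure_stopped_noiseSum_gt_le (h : P.Admissible S)
    (hSA : IsTwoTimescaleSA S α β n₀ θ w M₁ M₂)
    (hnoise : NoiseAssumption μ n₀ θ w M₁ M₂ P.m₁ P.m₂)
    (hMm : ∀ k ≥ n₀, Measurable[history n₀ θ w M₁ M₂ (k + 1)] (M (k + 1)))
    (hMi : ∀ k ≥ n₀, Integrable (M (k + 1)) μ)
    (hM0 : ∀ k ≥ n₀, μ[M (k + 1) | history n₀ θ w M₁ M₂ k] =ᵐ[μ] 0) {b : ℝ} (hb : 0 < b)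
    (hMb : ∀ k ≥ n₀, ∀ᵐ ω ∂μ, ‖M (k + 1) ω‖ ≤ b * (1 + ‖θ k ω‖ + ‖w k ω‖))
    {A : Mat d} {K q : ℝ} (hA : DecayBound A K q) {γ : ℕ → ℝ} (hγ : ∀ n, 0 < γ n) {t x : ℝ}
    (ht : 0 ≤ t) (hx : x ≤ t ^ 2 / (2 * d * (K * b * P.Rsum S) ^ 2)) {n : ℕ} (hn : n₀ ≤ n) :
    μ {ω | t < ‖noiseSum (op A) γ n₀ n
        fun k => (stayEvent P S n₀ θ w k).indicator (M (k + 1)) ω‖} ≤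
      2 * (d : ENNReal) ^ 2 * expTerm x (azumaSum γ q n) := by
  rw [mul_assoc K] at hx
  refine measure_noiseSum_gt_le (N := fun k => (stayEvent P S n₀ θ w k).indicator (M (k + 1)))
    h.dim_pos hnoise.history_le history_mono hn (fun k hk => ?_) (mul_pos hb h.Rsum_pos)
    (fun k hk => ?_) (fun k hk => ?_) hA hγ ht hx
  · exact ((hMm k hk).indicator (history_mono (Nat.le_succ k) _
      (measurableSet_stayEvent P hSA k))).stronglyMeasurable
  · filter_upwards [hMb k hk] with ω hω
    by_cases hG : ω ∈ stayEvent P S n₀ θ w k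
    · rw [Set.indicator_of_mem hG]
      exact hω.trans (mul_le_mul_of_nonneg_left
        (hG k (Finset.mem_Icc.2 ⟨hk, le_rfl⟩)).one_add_norm_le hb.le)
    · rw [Set.indicator_of_notMem hG, norm_zero]
      exact (mul_pos hb h.Rsum_pos).le
  · exact condExp_indicator_eq_zero (hMi k hk) (measurableSet_stayEvent P hSA k) (hM0 k hk)

end StoppedNoise

end TwoTS

end

/-! ### The union bound -/

theorem theorem1 {d : ℕ} (S : TwoTS.System d)
    (hW₂ : TwoTS.IsPosDef S.W₂) (hX₁ : TwoTS.IsPosDef S.X₁)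
    (α β : ℕ → ℝ) (hstep : TwoTS.StepsizeAssumption α β)
    (P : TwoTS.Params)
    (hK₁ : TwoTS.DecayBound S.X₁ P.K₁ P.q₁) (hK₂ : TwoTS.DecayBound S.W₂ P.K₂ P.q₂)
    (hq : P.q ∈ Set.Ioo 0 P.qmin)
    (hR₁ : 0 < P.R₁in) (hR₂ : 0 < P.R₂in) (hR₂out : P.R₂in < P.R₂out)
    (ε₁ ε₂ : ℝ) (hε₁ : ε₁ ∈ Set.Ioo 0 (min P.R₁in (4 * P.La S)))
    (hε₂ : ε₂ ∈ Set.Ioo 0 (min P.R₂in (P.R₂out - P.R₂in)))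
    (n₀ n₁ : ℕ) (hn₀ : P.N₀ S ε₁ ε₂ α β ≤ n₀) (hn₁ : P.N₁ S n₀ ε₁ ε₂ α β ≤ n₁)
    {Ω : Type*} [MeasurableSpace Ω] (μ : MeasureTheory.Measure Ω)
    [MeasureTheory.IsProbabilityMeasure μ]
    (θ w M₁ M₂ : ℕ → Ω → TwoTS.Vec d)
    (hSA : TwoTS.IsTwoTimescaleSA S α β n₀ θ w M₁ M₂)
    (hnoise : TwoTS.NoiseAssumption μ n₀ θ w M₁ M₂ P.m₁ P.m₂)
    (hθ₀ : ∀ᵐ ω ∂μ, ‖θ n₀ ω - S.θstar‖ ≤ P.R₁in)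
    (hz₀ : ∀ᵐ ω ∂μ, ‖TwoTS.zProc S θ w n₀ ω‖ ≤ P.R₂in) :
    1 - 2 * (d : ENNReal) ^ 2 * ∑' n : Set.Ici n₀,
        (TwoTS.expTerm (P.c₁ S * ε₁ ^ 2) (TwoTS.azumaSum α P.q₁ n)
          + TwoTS.expTerm (P.c₂ S * ε₂ ^ 2) (TwoTS.azumaSum β P.q₂ n)
          + TwoTS.expTerm (P.c₃ S * ε₁ ^ 2) (TwoTS.azumaSum β P.q₂ n))
      ≤ μ {ω | ∀ n ≥ n₁, ‖θ n ω - S.θstar‖ ≤ ε₁ ∧ ‖TwoTS.zProc S θ w n ω‖ ≤ ε₂} := by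
  obtain ⟨hε₁pos, hε₁lt⟩ := hε₁
  obtain ⟨hε₂pos, hε₂lt⟩ := hε₂
  have hε₁La : ε₁ < 4 * P.La S := hε₁lt.trans_le (min_le_right _ _)
  -- Positivity of `La` is not assumed: it follows from 0 < ε₁ < 4 La.
  have h : P.Admissible S := ⟨hW₂, hX₁, hK₁, hK₂, hq, hR₁, hR₂, hR₂out, hnoise.m₁_pos,
    hnoise.m₂_pos, by linarith⟩
  have hLc := h.Lc_pos
  set N₁ : ℕ → Ω → TwoTS.Vec d :=
    fun k => (TwoTS.stayEvent P S n₀ θ w k).indicator (M₁ (k + 1)) with hN₁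
  set N₂ : ℕ → Ω → TwoTS.Vec d :=
    fun k => (TwoTS.stayEvent P S n₀ θ w k).indicator (M₂ (k + 1)) with hN₂
  set E₁ : ℕ → Set Ω := fun n =>
    {ω | ε₁ / 4 < ‖TwoTS.noiseSum (TwoTS.op S.X₁) α n₀ n fun k => N₁ k ω‖} with hE₁
  set E₂ : ℕ → Set Ω := fun n =>
    {ω | ε₂ / 3 < ‖TwoTS.noiseSum (TwoTS.op S.W₂) β n₀ n fun k => N₂ k ω‖} with hE₂
  set E₃ : ℕ → Set Ω := fun n =>
    {ω | ε₁ / (8 * P.Lc S) < ‖TwoTS.noiseSum (TwoTS.op S.W₂) β n₀ n fun k => N₂ k ω‖} with hE₃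
  have hM₁m : ∀ k ≥ n₀, Measurable[TwoTS.history n₀ θ w M₁ M₂ (k + 1)] (M₁ (k + 1)) :=
    fun k hk => TwoTS.measurable_history_M₁ ⟨Nat.lt_succ_of_le hk, le_rfl⟩
  have hM₂m : ∀ k ≥ n₀, Measurable[TwoTS.history n₀ θ w M₁ M₂ (k + 1)] (M₂ (k + 1)) :=
    fun k hk => TwoTS.measurable_history_M₂ ⟨Nat.lt_succ_of_le hk, le_rfl⟩
  have hbound₁ : ∀ n ≥ n₀, μ (E₁ n) ≤ 2 * (d : ENNReal) ^ 2 *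
      TwoTS.expTerm (P.c₁ S * ε₁ ^ 2) (TwoTS.azumaSum α P.q₁ n) := fun n hn =>
    TwoTS.measure_stopped_noiseSum_gt_le h hSA hnoise hM₁m hnoise.M₁_int hnoise.M₁_condExp
      hnoise.m₁_pos hnoise.M₁_bound hK₁ hstep.α_pos (by positivity)
      (TwoTS.inv_mul_sq_le h.dim_pos (by norm_num) hK₁.one_le h.L₁md_pos
        (by rw [div_pow]; norm_num)) hn
  have hbound₂ : ∀ n ≥ n₀, μ (E₂ n) ≤ 2 * (d : ENNReal) ^ 2 *
      TwoTS.expTerm (P.c₂ S * ε₂ ^ 2) (TwoTS.azumaSum β P.q₂ n) := fun n hn =>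
    TwoTS.measure_stopped_noiseSum_gt_le h hSA hnoise hM₂m hnoise.M₂_int hnoise.M₂_condExp
      hnoise.m₂_pos hnoise.M₂_bound hK₂ hstep.β_pos (by positivity)
      (TwoTS.inv_mul_sq_le h.dim_pos (by norm_num) hK₂.one_le h.L₂md_pos
        (by rw [div_pow]; norm_num)) hn
  have hbound₃ : ∀ n ≥ n₀, μ (E₃ n) ≤ 2 * (d : ENNReal) ^ 2 *
      TwoTS.expTerm (P.c₃ S * ε₁ ^ 2) (TwoTS.azumaSum β P.q₂ n) := fun n hn =>
    TwoTS.measure_stopped_noiseSum_gt_le h hSA hnoise hM₂m hnoise.M₂_int hnoise.M₂_condExp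
      hnoise.m₂_pos hnoise.M₂_bound hK₂ hstep.β_pos (by positivity)
      (by
        rw [TwoTS.Params.c₃, mul_right_comm 64 (P.K₂ ^ 2)]
        exact TwoTS.inv_mul_sq_le h.dim_pos (by positivity) hK₂.one_le h.L₂md_pos
          (by rw [div_pow, mul_pow]; norm_num)) hn
  set good := {ω | ∀ n ≥ n₁, ‖θ n ω - S.θstar‖ ≤ ε₁ ∧ ‖TwoTS.zProc S θ w n ω‖ ≤ ε₂} with hgood
  have hn₀₁ : n₀ ≤ n₁ := (TwoTS.exp_decay_le_of_sInf_le hstep.β_pos hstep.β_sum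
    (C := P.K₂ * P.R₂in) (c := ε₂ / 3) (mul_pos h.K₂_pos h.R₂in_pos).le h.q₂_pos (by positivity)
    ((le_max_right _ _).trans hn₁)).1
  have hcover : ∀ᵐ ω ∂μ, ω ∈ good ∪ ⋃ n : Set.Ici n₀, (E₁ n ∪ E₂ n ∪ E₃ n) := by
    have hb₁ : ∀ᵐ ω ∂μ, ∀ k ≥ n₀, ‖M₁ (k + 1) ω‖ ≤ P.m₁ * (1 + ‖θ k ω‖ + ‖w k ω‖) :=
      MeasureTheory.ae_all_iff.2 fun k => MeasureTheory.ae_all_iff.2 (hnoise.M₁_bound k)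
    have hb₂ : ∀ᵐ ω ∂μ, ∀ k ≥ n₀, ‖M₂ (k + 1) ω‖ ≤ P.m₂ * (1 + ‖θ k ω‖ + ‖w k ω‖) :=
      MeasureTheory.ae_all_iff.2 fun k => MeasureTheory.ae_all_iff.2 (hnoise.M₂_bound k)
    filter_upwards [hb₁, hb₂, hθ₀, hz₀] with ω hb₁ω hb₂ω hθω hzω
    by_cases hω : ω ∈ ⋃ n : Set.Ici n₀, (E₁ n ∪ E₂ n ∪ E₃ n)
    · exact Or.inr hω
    · refine Or.inl fun n hn => ?_
      have hsmall : ∀ n ≥ n₀, ω ∉ E₁ n ∧ ω ∉ E₂ n ∧ ω ∉ E₃ n := by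
        intro n hn
        refine ⟨fun hE => hω ?_, fun hE => hω ?_, fun hE => hω ?_⟩
        · exact Set.mem_iUnion.2 ⟨⟨n, hn⟩, Or.inl (Or.inl hE)⟩
        · exact Set.mem_iUnion.2 ⟨⟨n, hn⟩, Or.inl (Or.inr hE)⟩
        · exact Set.mem_iUnion.2 ⟨⟨n, hn⟩, Or.inr hE⟩
      refine (TwoTS.inBall_and_close h hstep hε₁pos hε₁La hε₂pos
        (hε₂lt.trans_le (min_le_right _ _)) hn₀ hn₁ (θ := fun k => θ k ω) (w := fun k => w k ω)
        (M₁ := fun k => M₁ k ω) (M₂ := fun k => M₂ k ω) (fun k hk => (hSA k hk ω).1)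
        (fun k hk => (hSA k hk ω).2) hb₁ω hb₂ω hθω hzω (fun j hj hstay => ?_) n
        (hn₀₁.trans hn)).2 hn
      obtain ⟨h1, h2, h3⟩ := hsmall j hj
      simp only [hE₁, hE₂, hE₃, hN₁, hN₂, Set.mem_ofPred_eq, not_lt,
        TwoTS.noiseSum_indicator_eq _ _ hstay] at h1 h2 h3
      exact ⟨h1, h2, h3⟩
  -- Subtraction in `ENNReal` is truncated, so a divergent series needs no separate case.
  rw [tsub_le_iff_right]
  calc (1 : ENNReal) = μ Set.univ := MeasureTheory.measure_univ.symm
    _ ≤ μ (good ∪ ⋃ n : Set.Ici n₀, (E₁ n ∪ E₂ n ∪ E₃ n)) :=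
      MeasureTheory.measure_mono_ae (by filter_upwards [hcover] with ω hω _ using hω)
    _ ≤ μ good + ∑' n : Set.Ici n₀, μ (E₁ n ∪ E₂ n ∪ E₃ n) :=
      (MeasureTheory.measure_union_le _ _).trans
        (add_le_add_right (MeasureTheory.measure_iUnion_le _) _)
    _ ≤ _ := by
      rw [← ENNReal.tsum_mul_left]
      refine add_le_add_right (ENNReal.tsum_le_tsum fun n => ?_) _
      rw [mul_add, mul_add]
      refine (MeasureTheory.measure_union_le _ _).trans (add_le_add
        ((MeasureTheory.measure_union_le _ _).trans (add_le_add ?_ ?_)) ?_)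
      · exact hbound₁ n n.2
      · exact hbound₂ n n.2
      · exact hbound₃ n n.2
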